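/- Let $k$ be an algebraically closed field, $\bar X$ a normal projective (integral) variety over $k$, and $X\subset\bar X$ an open subscheme whose complement is a divisor (every irreducible component of $\bar X\setminus X$ has codimension one). Let $G$ be a finite group, $\pi:Y\to X$ a connected finite étale Galois covering with group $G$, and $\bar\pi:\bar Y\to\bar X$ the normalization of $\bar X$ in $Y$; $G$ acts on $\bar Y$ over $\bar X$. Let $D_0$ be an irreducible component of $\bar X_{\rm reg}\setminus X$ with generic point $\xi$, and let $\eta_1,\dots,\eta_t$ be the points of $\bar Y$ over $\xi$. Denote by $e$ the ramification index of the extension of discrete valuation rings $\mathcal O_{\bar X,\xi}\subset\mathcal O_{\bar Y,\eta_j}$, and by $f^{\rm sep}$, $f^{\rm insep}$ the separable and inseparable degrees of the residue field extension $k(\xi)\subset k(\eta_j)$; these numbers do not depend on $j$. A curve $\bar C\subset\bar X$ (an integral closed subscheme of dimension one), with $C=\bar C\cap X$, $D=Y\times_XC$, $\bar D=\bar Y\times_{\bar X}\bar C$ and normalization $\nu:\bar D^{\rm norm}\to\bar D$, is said to be in good position relative to $D_0$ if 1. $\bar C$ is smooth over $k$ and meets the reduced boundary $(\bar X\setminus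 X)_{\rm red}$ transversely, at points where $\bar X$ and $(\bar X\setminus X)_{\rm red}$ are regular (that is, the scheme-theoretic intersection $\bar C\cap(\bar X\setminus X)_{\rm red}$ is étale over $k$); 2. $D\to C$ is a connected finite étale Galois covering with group $G$; 3. $\nu$ is a universal homeomorphism; 4. for every closed point $x\in\bar C\cap D_0$ there are exactly $t\cdot f^{\rm sep}$ points of $\bar D$ over $x$. **Theorem.** Let $\bar C$ be a curve in good position relative to $D_0$, let $x\in\bar C\cap D_0$ be a closed point and let $y\in\bar D^{\rm norm}$ be a closed point mapping to $x$. Then the decomposition group $I^C_{y/x}=\{g\in G: g y=y\}$ satisfies $$|I^C_{y/x}|=e\cdot f^{\rm insep}.$$ -/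

import Mathlib

open CategoryTheory CategoryTheory.Limits AlgebraicGeometry

universe u v

namespace FierceRamification

noncomputable section

section Projective

variable (k : Type u) [Field k]

/-- The grading of `k[x₀, …, xₙ]` by the degree. -/
abbrev grading (n : ℕ) : ℕ → Submodule k (MvPolynomial (Fin (n + 1)) k) :=
  MvPolynomial.homogeneousSubmodule (Fin (n + 1)) k

instance (n : ℕ) : GradedAlgebra (grading k n) := MvPolynomial.gradedAlgebra

/-- Projective space `ℙⁿ` over the field `k`. -/
def projectiveSpace (n : ℕ) : Scheme.{u} := Proj (grading k n)

/-- The structure morphism of projective space. -/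
def projectiveSpaceMap (n : ℕ) : projectiveSpace k n ⟶ Spec (.of k) :=
  Proj.toSpecZero (grading k n) ≫ Spec.map (CommRingCat.ofHom (algebraMap k (grading k n 0)))

/-- `s : Z ⟶ Spec k` makes `Z` a normal projective variety over `k`: `Z` is integral, its local
rings are integrally closed, and it is a closed subscheme of some projective space over `k`. -/
structure IsNormalProjectiveVariety {Z : Scheme.{u}} (s : Z ⟶ Spec (.of k)) : Prop where
  isIntegral : IsIntegral Z
  normal : ∀ z : Z, IsIntegrallyClosed (Z.presheaf.stalk z)
  projective : ∃ (n : ℕ) (j : Z ⟶ projectiveSpace k n),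
    IsClosedImmersion j ∧ j ≫ projectiveSpaceMap k n = s

lemma algebraMap_gradeZero_surjective (n : ℕ) :
    Function.Surjective (algebraMap k (grading k n 0)) := by
  rintro ⟨p, hp⟩
  rw [MvPolynomial.mem_homogeneousSubmodule] at hp
  refine ⟨p.coeff 0, Subtype.ext ?_⟩
  have h := MvPolynomial.totalDegree_eq_zero_iff_eq_C.mp
    (Nat.le_zero.mp hp.totalDegree_le)
  exact h.symm

instance (n : ℕ) : LocallyOfFiniteType (projectiveSpaceMap k n) := by
  have : Algebra.FiniteType (grading k n 0) (MvPolynomial (Fin (n + 1)) k) :=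
    have : IsScalarTower k (grading k n 0) (MvPolynomial (Fin (n + 1)) k) :=
      IsScalarTower.of_algebraMap_eq (R := k) (S := grading k n 0)
        (A := MvPolynomial (Fin (n + 1)) k) fun _ ↦ rfl
    Algebra.FiniteType.of_restrictScalars_finiteType k _ _
  have : LocallyOfFiniteType
      (Spec.map (CommRingCat.ofHom (algebraMap k (grading k n 0)))) := by
    rw [HasRingHomProperty.Spec_iff (P := @LocallyOfFiniteType)]
    exact RingHom.FiniteType.of_surjective _ (algebraMap_gradeZero_surjective k n)
  exact inferInstanceAs (LocallyOfFiniteType (Proj.toSpecZero (grading k n) ≫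
    Spec.map (CommRingCat.ofHom (algebraMap k (grading k n 0)))))

lemma IsNormalProjectiveVariety.isLocallyNoetherian {k : Type u} [Field k] {Z : Scheme.{u}}
    {s : Z ⟶ Spec (.of k)} (h : IsNormalProjectiveVariety k s) : IsLocallyNoetherian Z := by
  obtain ⟨n, j, hj, rfl⟩ := h.projective
  have : IsNoetherianRing (CommRingCat.of k) := inferInstanceAs (IsNoetherianRing k)
  exact LocallyOfFiniteType.isLocallyNoetherian (j ≫ projectiveSpaceMap k n)

end Projective

section Loci

/-- The regular locus of a scheme. -/
def regularLocus (Z : Scheme.{u}) : Set Z :=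
  {z | IsRegularLocalRing (Z.presheaf.stalk z)}

/-- `D` is an irreducible component of the subspace `S`. -/
def IsComponent {T : Type*} [TopologicalSpace T] (S D : Set T) : Prop :=
  Maximal (fun E : Set T ↦ E ⊆ S ∧ IsIrreducible E) D

/-- `ξ` is a generic point of the subspace `D`. -/
def IsGenericIn {T : Type*} [TopologicalSpace T] (D : Set T) (ξ : T) : Prop :=
  ξ ∈ D ∧ D ⊆ closure {ξ}

/-- The complement of an open subscheme, with its reduced closed subscheme structure. -/
def reducedComplementIdeal {Z : Scheme.{u}} (U : Z.Opens) : Z.IdealSheafData :=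
  Scheme.IdealSheafData.vanishingIdeal ⟨(U : Set Z)ᶜ, U.isOpen.isClosed_compl⟩

end Loci

section Universal

/-- Universal homeomorphisms: every base change is a homeomorphism. -/
def IsUniversalHomeomorphism {X Y : Scheme.{u}} (f : X ⟶ Y) : Prop :=
  (topologically @IsHomeomorph).universally f

end Universal

section Actions

/-- A left action of a group `G` on a scheme `X`: `hom g` is the map `x ↦ g x`. -/
structure SchemeAction (G : Type v) [Group G] (X : Scheme.{u}) where
  /-- the map by which an element of the group acts -/
  hom : G → (X ⟶ X)
  hom_one : hom 1 = 𝟙 X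
  hom_mul : ∀ g h, hom (g * h) = hom h ≫ hom g

namespace SchemeAction

variable {G : Type v} [Group G] {X S Z : Scheme.{u}}

lemma hom_inv_comp (a : SchemeAction G X) (g : G) : a.hom g⁻¹ ≫ a.hom g = 𝟙 X := by
  rw [← a.hom_mul, mul_inv_cancel, a.hom_one]

lemma hom_comp_inv (a : SchemeAction G X) (g : G) : a.hom g ≫ a.hom g⁻¹ = 𝟙 X := by
  rw [← a.hom_mul, inv_mul_cancel, a.hom_one]

/-- The trivial action. -/
def trivial (G : Type v) [Group G] (X : Scheme.{u}) : SchemeAction G X where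
  hom _ := 𝟙 X
  hom_one := rfl
  hom_mul _ _ := (Category.comp_id _).symm

/-- The morphism `f` is equivariant for the actions `a` and `b`. -/
abbrev Equivariant (a : SchemeAction G X) (b : SchemeAction G S) (f : X ⟶ S) : Prop :=
  ∀ g, a.hom g ≫ f = f ≫ b.hom g

/-- The action `a` is an action over `S`: it commutes with the structure morphism `f`. -/
abbrev IsOver (a : SchemeAction G X) (f : X ⟶ S) : Prop :=
  ∀ g, a.hom g ≫ f = f

/-- The subgroup of the elements fixing the point `x`. -/
def stabilizer (a : SchemeAction G X) (x : X) : Subgroup G where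
  carrier := {g | a.hom g x = x}
  one_mem' := by
    change a.hom 1 x = x
    rw [a.hom_one]; rfl
  mul_mem' {g h} hg hh := by
    change a.hom (g * h) x = x
    change a.hom g x = x at hg
    change a.hom h x = x at hh
    rw [a.hom_mul, Scheme.Hom.comp_apply, hh, hg]
  inv_mem' {g} hg := by
    change a.hom g⁻¹ x = x
    change a.hom g x = x at hg
    have h : (a.hom g ≫ a.hom g⁻¹) x = x := by rw [a.hom_comp_inv]; rfl
    rwa [Scheme.Hom.comp_apply, hg] at h

/-- The endomorphism of `X ×_S Z` given by the action of `g` on `X` and the identity of `Z`. -/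
def baseChangeMap (a : SchemeAction G X) {f : X ⟶ S} (ha : a.IsOver f) (i : Z ⟶ S) (g : G) :
    pullback f i ⟶ pullback f i :=
  pullback.lift (pullback.fst f i ≫ a.hom g) (pullback.snd f i)
    (by rw [Category.assoc, ha g, pullback.condition])

lemma baseChangeMap_fst (a : SchemeAction G X) {f : X ⟶ S} (ha : a.IsOver f) (i : Z ⟶ S) (g : G) :
    a.baseChangeMap ha i g ≫ pullback.fst f i = pullback.fst f i ≫ a.hom g :=
  pullback.lift_fst _ _ _

lemma baseChangeMap_snd (a : SchemeAction G X) {f : X ⟶ S} (ha : a.IsOver f) (i : Z ⟶ S) (g : G) :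
    a.baseChangeMap ha i g ≫ pullback.snd f i = pullback.snd f i :=
  pullback.lift_snd _ _ _

/-- The base change along `i : Z ⟶ S` of an action on `X` over `S`. -/
def baseChange (a : SchemeAction G X) {f : X ⟶ S} (ha : a.IsOver f) (i : Z ⟶ S) :
    SchemeAction G (pullback f i) where
  hom := a.baseChangeMap ha i
  hom_one := by
    apply pullback.hom_ext
    · rw [baseChangeMap_fst, a.hom_one, Category.id_comp, Category.comp_id]
    · rw [baseChangeMap_snd, Category.id_comp]
  hom_mul g h := by
    apply pullback.hom_ext
    · rw [Category.assoc, baseChangeMap_fst, baseChangeMap_fst,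
        reassoc_of% (a.baseChangeMap_fst ha i h), a.hom_mul]
    · rw [Category.assoc, baseChangeMap_snd, baseChangeMap_snd, baseChangeMap_snd]

section Normalization

variable (f : X ⟶ S) [QuasiCompact f] [QuasiSeparated f]
  (a : SchemeAction G X) (b : SchemeAction G S)

lemma factor (w : a.Equivariant b f) (g : G) :
    f = (a.hom g ≫ f.toNormalization) ≫ f.fromNormalization ≫ b.hom g⁻¹ := by
  rw [Category.assoc, f.toNormalization_fromNormalization_assoc, reassoc_of% (w g),
    b.hom_comp_inv, Category.comp_id]

variable (w : a.Equivariant b f)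

/-- The endomorphism of the relative normalization of `S` in `X` induced by the action of `g`. -/
def normMap (g : G) : f.normalization ⟶ f.normalization :=
  have : IsIso (b.hom g⁻¹) := ⟨b.hom g, b.hom_inv_comp g, b.hom_comp_inv g⟩
  f.normalizationDesc (a.hom g ≫ f.toNormalization) (f.fromNormalization ≫ b.hom g⁻¹)
    (factor f a b w g)

lemma toNormalization_normMap (g : G) :
    f.toNormalization ≫ normMap f a b w g = a.hom g ≫ f.toNormalization :=
  have : IsIso (b.hom g⁻¹) := ⟨b.hom g, b.hom_inv_comp g, b.hom_comp_inv g⟩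
  f.toNormalization_normalizationDesc _ _ (factor f a b w g)

lemma normMap_fromNormalization (g : G) :
    normMap f a b w g ≫ f.fromNormalization = f.fromNormalization ≫ b.hom g := by
  have : IsIso (b.hom g⁻¹) := ⟨b.hom g, b.hom_inv_comp g, b.hom_comp_inv g⟩
  have h : normMap f a b w g ≫ f.fromNormalization ≫ b.hom g⁻¹ = f.fromNormalization :=
    f.normalizationDesc_comp _ _ (factor f a b w g)
  have h' := congr($h ≫ b.hom g)
  rwa [Category.assoc, Category.assoc, b.hom_inv_comp, Category.comp_id] at h'

lemma normalization_hom_ext (g : G) {p q : f.normalization ⟶ f.normalization}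
    (h : f.toNormalization ≫ p = f.toNormalization ≫ q)
    (hp : p ≫ f.fromNormalization = f.fromNormalization ≫ b.hom g)
    (hq : q ≫ f.fromNormalization = f.fromNormalization ≫ b.hom g) : p = q :=
  have : IsIso (b.hom g⁻¹) := ⟨b.hom g, b.hom_inv_comp g, b.hom_comp_inv g⟩
  Scheme.Hom.normalization.hom_ext f p q (f.fromNormalization ≫ b.hom g⁻¹) h
    (by rw [reassoc_of% hp, b.hom_comp_inv, Category.comp_id])
    (by rw [reassoc_of% hq, b.hom_comp_inv, Category.comp_id])

/-- The action on the relative normalization of `S` in `X` induced by compatible actions `a` on `X`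
and `b` on `S`. It is the unique action for which `X ⟶ f.normalization ⟶ S` are equivariant. -/
def normalization : SchemeAction G f.normalization where
  hom := normMap f a b w
  hom_one := normalization_hom_ext f b 1
    (by rw [toNormalization_normMap, a.hom_one, Category.id_comp, Category.comp_id])
    (normMap_fromNormalization ..)
    (by rw [b.hom_one, Category.id_comp, Category.comp_id])
  hom_mul g h := normalization_hom_ext f b (g * h)
    (by rw [toNormalization_normMap, reassoc_of% (toNormalization_normMap f a b w h),
      toNormalization_normMap, a.hom_mul, Category.assoc])
    (normMap_fromNormalization ..)
    (by rw [Category.assoc, normMap_fromNormalization,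
      reassoc_of% (normMap_fromNormalization f a b w h), b.hom_mul])

end Normalization

end SchemeAction

/-- `π : Y ⟶ X` with the action `ρ` of `G` on `Y` over `X` is a (connected) finite étale Galois
covering with group `G`: it is finite étale and surjective, `Y` is connected, and
`(g, y) ↦ (y, g y)` is an isomorphism from `G × Y` to `Y ×_X Y`. -/
structure IsGaloisCovering {X Y : Scheme.{u}} (π : Y ⟶ X) {G : Type v} [Group G] [Finite G]
    (ρ : SchemeAction G Y) : Prop where
  isFinite : IsFinite π
  etale : Etale π
  surjective : Surjective π
  connected : ConnectedSpace Y
  isOver : ρ.IsOver π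
  torsor : IsIso (Sigma.desc (fun g : G ↦
    (pullback.lift (𝟙 Y) (ρ.hom g) ((Category.id_comp _).trans (isOver g).symm) :
      Y ⟶ pullback π π)))

end Actions

/-- A normal projective variety `Xbar` over `k`, an open subscheme `X` whose complement is a divisor
(of pure codimension one), and a finite étale Galois covering `π : Y ⟶ X` with group `G`. -/
structure CoverSetup (k : Type u) [Field k] (G : Type v) [Group G] [Finite G] where
  /-- the normal projective variety -/
  Xbar : Scheme.{u}
  /-- its structure morphism -/
  s : Xbar ⟶ Spec (.of k)
  isVariety : IsNormalProjectiveVariety k s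
  /-- the open subscheme -/
  X : Xbar.Opens
  isDivisor : ∀ (D : Set Xbar) (z : Xbar), IsComponent (X : Set Xbar)ᶜ D → IsGenericIn D z →
    ringKrullDim (Xbar.presheaf.stalk z) = 1
  /-- the total space of the covering -/
  Y : Scheme.{u}
  /-- the covering -/
  π : Y ⟶ X
  /-- the Galois action -/
  ρ : SchemeAction G Y
  isGalois : IsGaloisCovering π ρ

namespace CoverSetup

variable {k : Type u} [Field k] {G : Type v} [Group G] [Finite G] (S : CoverSetup k G)

instance : IsLocallyNoetherian S.Xbar := S.isVariety.isLocallyNoetherian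

instance : IsFinite S.π := S.isGalois.isFinite

/-- The normalization of `Xbar` in `Y`. -/
def Ybar : Scheme.{u} := (S.π ≫ S.X.ι).normalization

/-- The projection of `Ybar` to `Xbar`. -/
def πbar : S.Ybar ⟶ S.Xbar := (S.π ≫ S.X.ι).fromNormalization

/-- The inclusion of `Y` into `Ybar`. -/
def inclY : S.Y ⟶ S.Ybar := (S.π ≫ S.X.ι).toNormalization

lemma inclY_πbar : S.inclY ≫ S.πbar = S.π ≫ S.X.ι :=
  (S.π ≫ S.X.ι).toNormalization_fromNormalization

instance : IsIntegralHom S.πbar := inferInstanceAs (IsIntegralHom (S.π ≫ S.X.ι).fromNormalization)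

lemma ρ_equivariant :
    S.ρ.Equivariant (SchemeAction.trivial G S.Xbar) (S.π ≫ S.X.ι) := fun g ↦ by
  rw [← Category.assoc, S.isGalois.isOver g]
  exact (Category.comp_id _).symm

/-- The action of `G` on `Ybar`, extending the one on `Y`. -/
def actionYbar : SchemeAction G S.Ybar :=
  SchemeAction.normalization (S.π ≫ S.X.ι) S.ρ (SchemeAction.trivial G S.Xbar) S.ρ_equivariant

lemma actionYbar_isOver : S.actionYbar.IsOver S.πbar := fun g ↦
  (SchemeAction.normMap_fromNormalization (S.π ≫ S.X.ι) S.ρ _ S.ρ_equivariant g).trans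
    (Category.comp_id _)

lemma inclY_equivariant : S.ρ.Equivariant S.actionYbar S.inclY := fun g ↦
  (SchemeAction.toNormalization_normMap (S.π ≫ S.X.ι) S.ρ _ S.ρ_equivariant g).symm

/-- The ramification index of `Xbar` in `Ybar` at a point `η` of `Ybar`, for the extension of local
rings `𝒪_{Xbar, πbar η} ⟶ 𝒪_{Ybar, η}`. -/
def ramificationIndex (η : S.Ybar) : ℕ :=
  letI := (S.πbar.stalkMap η).hom.toAlgebra
  (IsLocalRing.maximalIdeal (S.Ybar.presheaf.stalk η)).ramificationIdx
    (S.Xbar.presheaf.stalk (S.πbar η))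

/-- The separable degree of the residue field extension at a point `η` of `Ybar`. -/
def residueSepDegree (η : S.Ybar) : ℕ :=
  letI := (S.πbar.residueFieldMap η).hom.toAlgebra
  Field.finSepDegree (S.Xbar.residueField (S.πbar η)) (S.Ybar.residueField η)

/-- The inseparable degree of the residue field extension at a point `η` of `Ybar`. -/
def residueInsepDegree (η : S.Ybar) : ℕ :=
  letI := (S.πbar.residueFieldMap η).hom.toAlgebra
  Field.finInsepDegree (S.Xbar.residueField (S.πbar η)) (S.Ybar.residueField η)

section Curve

variable {Cbar : Scheme.{u}} (i : Cbar ⟶ S.Xbar)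

/-- The part `C` of the curve `Cbar` lying in `X`. -/
abbrev C : Cbar.Opens := i ⁻¹ᵁ S.X

/-- The restriction `D = Y ×_X C` of the covering to the curve. -/
def D : Scheme.{u} := pullback S.π (i ∣_ S.X)

/-- The projection of `D` to `Y`. -/
def Dfst : S.D i ⟶ S.Y := pullback.fst S.π (i ∣_ S.X)

/-- The projection of `D` to `C`. -/
def πC : S.D i ⟶ (S.C i).toScheme := pullback.snd S.π (i ∣_ S.X)

/-- The action of `G` on `D` over `C`. -/
def actionD : SchemeAction G (S.D i) := S.ρ.baseChange S.isGalois.isOver (i ∣_ S.X)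

/-- The scheme `Dbar = Ybar ×_Xbar Cbar`. -/
def Dbar : Scheme.{u} := pullback S.πbar i

/-- The projection of `Dbar` to `Ybar`. -/
def Dbarfst : S.Dbar i ⟶ S.Ybar := pullback.fst S.πbar i

/-- The projection of `Dbar` to `Cbar`. -/
def πbarC : S.Dbar i ⟶ Cbar := pullback.snd S.πbar i

/-- The action of `G` on `Dbar` over `Cbar`. -/
def actionDbar : SchemeAction G (S.Dbar i) := S.actionYbar.baseChange S.actionYbar_isOver i

/-- The open immersion of `D` into `Dbar`. -/
def inclD : S.D i ⟶ S.Dbar i :=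
  pullback.map S.π (i ∣_ S.X) S.πbar i S.inclY (S.C i).ι S.X.ι S.inclY_πbar.symm
    (morphismRestrict_ι i S.X)

lemma inclD_πbarC : S.inclD i ≫ S.πbarC i = S.πC i ≫ (S.C i).ι := by
  exact pullback.lift_snd _ _ _

lemma inclD_equivariant : (S.actionD i).Equivariant (S.actionDbar i) (S.inclD i) := fun g ↦ by
  have h : S.inclD i ≫ S.Dbarfst i = S.Dfst i ≫ S.inclY := pullback.lift_fst _ _ _
  have h₁ : (S.actionD i).hom g ≫ S.Dfst i = S.Dfst i ≫ S.ρ.hom g :=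
    S.ρ.baseChangeMap_fst S.isGalois.isOver _ g
  have h₂ : (S.actionDbar i).hom g ≫ S.Dbarfst i = S.Dbarfst i ≫ S.actionYbar.hom g :=
    S.actionYbar.baseChangeMap_fst S.actionYbar_isOver _ g
  have h₃ : (S.actionD i).hom g ≫ S.πC i = S.πC i :=
    S.ρ.baseChangeMap_snd S.isGalois.isOver _ g
  have h₄ : (S.actionDbar i).hom g ≫ S.πbarC i = S.πbarC i :=
    S.actionYbar.baseChangeMap_snd S.actionYbar_isOver _ g
  refine pullback.hom_ext (f := S.πbar) (g := i) ?_ ?_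
  · change ((S.actionD i).hom g ≫ S.inclD i) ≫ S.Dbarfst i =
      (S.inclD i ≫ (S.actionDbar i).hom g) ≫ S.Dbarfst i
    rw [Category.assoc, Category.assoc, h₂, h, reassoc_of% h₁, reassoc_of% h,
      S.inclY_equivariant g]
  · change ((S.actionD i).hom g ≫ S.inclD i) ≫ S.πbarC i =
      (S.inclD i ≫ (S.actionDbar i).hom g) ≫ S.πbarC i
    rw [Category.assoc, Category.assoc, h₄, inclD_πbarC, reassoc_of% h₃]

instance : IsFinite (S.πC i) := inferInstanceAs (IsFinite (pullback.snd S.π (i ∣_ S.X)))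

instance : IsIntegralHom (S.πbarC i) := inferInstanceAs (IsIntegralHom (pullback.snd S.πbar i))

instance : QuasiCompact (S.C i).ι :=
  MorphismProperty.of_isPullback (P := @QuasiCompact) (isPullback_morphismRestrict i S.X)
    (inferInstanceAs (QuasiCompact S.X.ι))

instance : QuasiCompact (S.inclD i) := by
  have : QuasiCompact (S.inclD i ≫ S.πbarC i) := by rw [inclD_πbarC]; infer_instance
  exact .of_comp _ (S.πbarC i)

instance : QuasiSeparated (S.inclD i) := by
  have : QuasiSeparated (S.inclD i ≫ S.πbarC i) := by rw [inclD_πbarC]; infer_instance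
  exact .of_comp _ (S.πbarC i)

/-- The normalization of `Dbar`, formed as the relative normalization of `Dbar` in `D`. For a smooth
integral curve `Cbar` meeting `X`, the scheme `D` is étale over the smooth curve `C`, hence normal, and
it is a dense open subscheme of `Dbar`; so this is the integral closure of `Dbar` in its ring of
rational functions. -/
def Dnorm : Scheme.{u} := (S.inclD i).normalization

/-- The normalization morphism. -/
def ν : S.Dnorm i ⟶ S.Dbar i := (S.inclD i).fromNormalization

/-- The action of `G` on the normalization of `Dbar`, induced by the one on `Dbar`. -/
def actionDnorm : SchemeAction G (S.Dnorm i) :=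
  SchemeAction.normalization (S.inclD i) (S.actionD i) (S.actionDbar i) (S.inclD_equivariant i)

lemma ν_equivariant : (S.actionDnorm i).Equivariant (S.actionDbar i) (S.ν i) :=
  SchemeAction.normMap_fromNormalization (S.inclD i) _ _ (S.inclD_equivariant i)

/-- The decomposition group in `G` of a point `y` of the normalization of `Dbar`. -/
def decompositionGroup (y : S.Dnorm i) : Subgroup G := (S.actionDnorm i).stabilizer y

/-- The reduced boundary `(Xbar ∖ X)_red`. -/
def boundary : Scheme.{u} := (reducedComplementIdeal S.X).subscheme

/-- The inclusion of the reduced boundary. -/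
def boundaryι : S.boundary ⟶ S.Xbar := (reducedComplementIdeal S.X).subschemeι

/-- `i : Cbar ⟶ Xbar` is a curve in good position relative to the irreducible component `D₀` of
the part of the boundary in the regular locus; `ξ` is the generic point of `D₀`. -/
structure IsInGoodPosition (D₀ : Set S.Xbar) (ξ : S.Xbar) : Prop where
  -- `Cbar` is an integral closed subscheme of dimension one
  isClosedImmersion : IsClosedImmersion i
  isIntegral : IsIntegral Cbar
  dim_eq_one : topologicalKrullDim Cbar = 1
  -- `Cbar` is smooth and meets the reduced boundary transversely, at regular points of `Xbar` and
  -- of the reduced boundary: the scheme-theoretic intersection is smooth of dimension zero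
  smooth : Smooth (i ≫ S.s)
  regular : ∀ c : Cbar, i c ∉ S.X → i c ∈ regularLocus S.Xbar
  regular_boundary : ∀ (c : Cbar) (b : S.boundary), S.boundaryι b = i c →
    b ∈ regularLocus S.boundary
  transverse : Etale (pullback.fst i S.boundaryι ≫ i ≫ S.s)
  -- the restriction of the covering to `C` is a (connected) Galois covering with group `G`
  isGalois : IsGaloisCovering (S.πC i) (S.actionD i)
  -- the normalization of `Dbar` is a universal homeomorphism
  unibranch : IsUniversalHomeomorphism (S.ν i)
  -- the fibers of `Dbar` over the points of `Cbar ∩ D₀` have `t * f^sep` points, where `t` is the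
  -- number of points of `Ybar` over `ξ`
  card_fiber : ∀ c : Cbar, IsClosed {c} → i c ∈ D₀ → ∀ η : S.Ybar, S.πbar η = ξ →
    {d : S.Dbar i | S.πbarC i d = c}.ncard =
      {η' : S.Ybar | S.πbar η' = ξ}.ncard * S.residueSepDegree η

end Curve

end CoverSetup

end

end FierceRamification

/-! The order of G is counted twice.

On the curve: the stabilizer of y has index equal to the size of the orbit of y. Since `ν` is
injective, this orbit has as many points as its image in `Dbar`, and that image is the whole fibre
over x (`range_actionDnorm`): `Dbar` is closed in `Ybar`, and G permutes the fibres of `Ybar`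
transitively. Good position says that the fibre has t · f^sep points, so |G| = t · f^sep · |I|.

At the generic point ξ of the boundary component: ξ has codimension at most one, and the fundamental
identity gives |G| = t · e · f^sep · f^insep (`ncard_fiber_mul_ramificationIndex`). Cancelling t ·
f^sep proves the claim.

Transitivity and the fundamental identity both rest on one algebraic fact, `isInvariant_and_finite`:
over an affine open of `Xbar`, the ring B of `Ybar` is a finite torsion-free module of rank |G| over
the ring A of `Xbar`, with invariant ring A. This is descended from a basic open inside X, where the
Galois condition says that B' ⊗ B' is the ring of functions G → B'. Invariants and rank follow by
flat descent and base change. Finiteness follows from a trace argument, with normality of A bringing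
traces of integral elements back into A. -/

namespace FierceRamification

open scoped TensorProduct Pointwise

/-! ### Galois algebras: invariants and rank from the torsor condition. -/

section GaloisAlgebra

variable (R S G : Type*) [CommRing R] [CommRing S] [Algebra R S] [Group G]
  [MulSemiringAction G S] [SMulCommClass G R S]

/-- For a group `G` acting on an `R`-algebra `S`, the map `x ⊗ y ↦ (x * g • y)_g`. -/
noncomputable def torsorMap : S ⊗[R] S →ₐ[S] (G → S) :=
  Algebra.TensorProduct.lift (Algebra.ofId S (G → S))
    (AlgHom.pi fun g ↦ MulSemiringAction.toAlgHom R S g) fun _ _ ↦ Commute.all _ _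

@[simp]
lemma torsorMap_tmul (x y : S) (g : G) : torsorMap R S G (x ⊗ₜ y) g = x * g • y := by
  simp [torsorMap, Algebra.ofId_apply]

variable {R S G}

/-- For invariant s, the elements s ⊗ 1 and 1 ⊗ s have the same image, so they agree; by faithfully
flat descent s then comes from R. -/
lemma isInvariant_of_torsorMap_injective [Module.FaithfullyFlat R S]
    (h : Function.Injective (torsorMap R S G)) : Algebra.IsInvariant R S G where
  isInvariant s hs := by
    refine ((Algebra.IsEffective.of_faithfullyFlat R S) s).mp ?_
    rw [Algebra.TensorProduct.includeLeftSubRight_apply, sub_eq_zero]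
    refine h (funext fun g ↦ ?_)
    simp [hs g]

/-- After base change to S, the module S becomes free of rank |G|. Base change preserves the rank at
a prime, and for a finite flat module over a domain this is the generic rank. -/
lemma finrank_eq_card_of_torsorMap_bijective [IsDomain R] [Nontrivial S] [Module.Finite R S]
    [Module.Flat R S] [Finite G] (h : Function.Bijective (torsorMap R S G)) :
    Module.finrank R S = Nat.card G := by
  cases nonempty_fintype G
  obtain ⟨P⟩ : Nonempty (PrimeSpectrum S) := inferInstance
  have h₁ := Module.rankAtStalk_baseChange (M := S) (R := R) P
  rw [Module.rankAtStalk_eq_of_equiv (AlgEquiv.ofBijective _ h).toLinearEquiv,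
    Module.rankAtStalk_eq_finrank_of_free, Pi.natCast_apply, Module.finrank_pi, Nat.cast_id] at h₁
  rw [Nat.card_eq_fintype_card, h₁, ← Ideal.finrank_fiber_eq_finrank
    (P.comap (algebraMap R S)).asIdeal, Ideal.finrank_fiber_eq_rankAtStalk]

end GaloisAlgebra

/-! ### Descending invariants and finiteness from A[1/a] to a normal domain A. -/

section RamifiedExtension

variable {A A' B B' G : Type*} [CommRing A] [CommRing A'] [CommRing B] [CommRing B']
  [Algebra A A'] [Algebra A B] [Algebra A B'] [Algebra A' B'] [Algebra B B']
  [IsScalarTower A A' B'] [IsScalarTower A B B']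
  [Group G] [Finite G] [MulSemiringAction G B'] [SMulCommClass G A' B']
  [IsDomain A] [IsIntegrallyClosed A] {a : A} (ha : a ≠ 0)
  [IsLocalization.Away a A'] [IsLocalization.Away (algebraMap A B a) B']

-- A' embeds in the fraction field of A, where normality applies.
include ha in
lemma mem_range_of_isIntegral_away {x : A'} (hx : IsIntegral A x) :
    x ∈ Set.range (algebraMap A A') := by
  have hle : Submonoid.powers a ≤ nonZeroDivisors A := powers_le_nonZeroDivisors_of_noZeroDivisors ha
  let φ : A' →ₐ[A] FractionRing A := IsLocalization.liftAlgHom (M := Submonoid.powers a)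
    (f := Algebra.ofId A (FractionRing A)) fun y ↦ by
      simpa [Algebra.ofId_apply] using nonZeroDivisors.ne_zero (hle y.2)
  have hφ : Function.Injective φ := by
    rw [← AlgHom.coe_toRingHom]
    exact (IsLocalization.lift_injective_iff _).mpr fun x y ↦
      by simp [(IsLocalization.injective A' hle).eq_iff]
  obtain ⟨y, hy⟩ := IsIntegrallyClosed.isIntegral_iff.mp (hx.map φ)
  exact ⟨y, hφ (by simpa using hy)⟩

include ha in
omit [Finite G] [SMulCommClass G A' B'] [IsLocalization.Away (algebraMap A B a) B'] in
lemma isInvariant_of_away [MulSemiringAction G B] [SMulDistribClass G B B']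
    [Module.FaithfullyFlat A' B'] [Algebra.IsIntegral A B]
    (hB : Function.Injective (algebraMap B B'))
    (h : Algebra.IsInvariant A' B' G) : Algebra.IsInvariant A B G where
  isInvariant b hb := by
    obtain ⟨x, hx⟩ := h.isInvariant (algebraMap B B' b) fun g ↦ by
      rw [← algebraMap.coe_smul', hb]
    have hxi : IsIntegral A x := by
      rw [← isIntegral_algHom_iff (IsScalarTower.toAlgHom A A' B')
        (FaithfulSMul.algebraMap_injective A' B')]
      simpa [hx] using (Algebra.IsIntegral.isIntegral (R := A) b).algebraMap
    obtain ⟨y, rfl⟩ := mem_range_of_isIntegral_away ha hxi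
    refine ⟨y, hB ?_⟩
    rw [← hx, ← IsScalarTower.algebraMap_apply, ← IsScalarTower.algebraMap_apply]

-- Trace argument: with a dual system ∑ uᵢ · g(vᵢ) = δ_{g,1} one has b = ∑ uᵢ Tr(vᵢ b). Clearing the
-- denominators of the vᵢ by aⁿ makes the traces lie in A, so aⁿB sits in the finitely generated
-- A-module spanned by the uᵢ. Since A is noetherian and a is invertible in B', B is finite.
include ha in
lemma finite_of_away [IsNoetherianRing A] [Module.FaithfullyFlat A' B'] [Algebra.IsIntegral A B]
    (hB : Function.Injective (algebraMap B B')) (hstable : ∀ (g : G) (b : B),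
      g • algebraMap B B' b ∈ Set.range (algebraMap B B'))
    (h : Algebra.IsInvariant A' B' G) (hs : Function.Surjective (torsorMap A' B' G)) :
    Module.Finite A B := by
  classical
  cases nonempty_fintype G
  -- A preimage of the indicator function of 1 ∈ G is the dual system.
  obtain ⟨t, ht⟩ := hs (Pi.single 1 1)
  obtain ⟨s, rfl⟩ := TensorProduct.exists_finset t
  obtain ⟨⟨_, n, rfl⟩, hn⟩ := IsLocalization.exist_integer_multiples_of_finset
    (Submonoid.powers (algebraMap A B a)) (s.image Prod.snd)
  -- Here c i = aⁿ · vᵢ; pairs outside s get the dummy value 0, so that c is a total function.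
  have hc : ∀ i : B' × B', ∃ c : B, i ∈ s → algebraMap B B' c = algebraMap A B' a ^ n * i.2 := by
    intro i
    by_cases hi : i ∈ s
    · obtain ⟨c, hc⟩ := hn i.2 (Finset.mem_image_of_mem _ hi)
      refine ⟨c, fun _ ↦ hc.trans ?_⟩
      simp [Algebra.smul_def, ← IsScalarTower.algebraMap_apply]
    · exact ⟨0, fun h ↦ absurd h hi⟩
  choose c hc using hc
  -- The trace is invariant, hence in A', and a sum of integral conjugates, hence in A.
  have htr : ∀ b : B, ∃ r : A, algebraMap A B' r = ∑ g : G, g • algebraMap B B' b := by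
    intro b
    obtain ⟨x, hx⟩ := h.isInvariant (∑ g : G, g • algebraMap B B' b) fun g ↦ by
      rw [Finset.smul_sum]
      exact Fintype.sum_equiv (Equiv.mulLeft g) _ _ fun k ↦ by simp [mul_smul]
    have hxi : IsIntegral A x := by
      rw [← isIntegral_algHom_iff (IsScalarTower.toAlgHom A A' B')
        (FaithfulSMul.algebraMap_injective A' B')]
      simp only [IsScalarTower.coe_toAlgHom', hx]
      refine IsIntegral.sum _ fun g _ ↦ ?_
      obtain ⟨b', hb'⟩ := hstable g b
      exact hb' ▸ (Algebra.IsIntegral.isIntegral (R := A) b').algebraMap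
    obtain ⟨y, rfl⟩ := mem_range_of_isIntegral_away ha hxi
    exact ⟨y, by rw [← hx, ← IsScalarTower.algebraMap_apply]⟩
  have hexp : ∀ b : B, algebraMap A B' a ^ n * algebraMap B B' b =
      ∑ i ∈ s, i.1 * ∑ g : G, g • algebraMap B B' (c i * b) := by
    intro b
    have key : ∀ g : G, ∑ i ∈ s, i.1 * g • i.2 = if g = 1 then 1 else 0 := fun g ↦ by
      have := congr_fun ht g
      simpa [Pi.single_apply] using this
    have hfix : ∀ g : G, g • (algebraMap A B' a ^ n) = algebraMap A B' a ^ n := fun g ↦ by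
      rw [IsScalarTower.algebraMap_apply A A' B', smul_pow', smul_algebraMap]
    calc _ = ∑ g : G, (∑ i ∈ s, i.1 * g • i.2) * (algebraMap A B' a ^ n * g • algebraMap B B' b) := by
          simp [key]
      _ = _ := by
          simp_rw [Finset.sum_mul, Finset.mul_sum]
          rw [Finset.sum_comm]
          refine Finset.sum_congr rfl fun i hi ↦ Finset.sum_congr rfl fun g _ ↦ ?_
          rw [map_mul, hc i hi, smul_mul', smul_mul', hfix]
          ring
  -- Multiplication by aⁿ embeds B in the noetherian module N.
  let N : Submodule A B' := Submodule.span A (s.image Prod.fst : Finset B')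
  have hN : IsNoetherian A N := isNoetherian_span_of_finite A (Finset.finite_toSet _)
  let f : B →ₗ[A] N := LinearMap.codRestrict N
    ((a ^ n) • (IsScalarTower.toAlgHom A B B').toLinearMap) fun b ↦ by
      have : (a ^ n • (IsScalarTower.toAlgHom A B B').toLinearMap) b =
          ∑ i ∈ s, i.1 * ∑ g : G, g • algebraMap B B' (c i * b) := by
        rw [← hexp]
        simp [Algebra.smul_def]
      rw [this]
      refine Submodule.sum_mem _ fun i hi ↦ ?_
      obtain ⟨r, hr⟩ := htr (c i * b)
      rw [← hr, mul_comm, ← Algebra.smul_def]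
      exact Submodule.smul_mem _ _ (Submodule.subset_span (by
        simpa using ⟨i.2, hi⟩))
  refine Module.Finite.of_injective f ?_
  intro b₁ b₂ hb
  have hb' : a ^ n • algebraMap B B' b₁ = a ^ n • algebraMap B B' b₂ := congr_arg Subtype.val hb
  have hu : IsUnit (algebraMap A B' (a ^ n)) := by
    rw [map_pow, IsScalarTower.algebraMap_apply A A' B']
    exact ((IsLocalization.Away.algebraMap_isUnit a).map _).pow n
  rw [Algebra.smul_def, Algebra.smul_def] at hb'
  exact hB (hu.mul_left_cancel hb')

end RamifiedExtension

/-! ### The identity "number of primes × e × f = |G|". -/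

section FundamentalIdentity

variable {A B G : Type*} [CommRing A] [IsDomain A] [CommRing B] [Algebra A B]
  [Module.Finite A B] [Module.IsTorsionFree A B]

-- Over the local Dedekind domain A_p, torsion-free means flat, and finite flat means free; so the
-- fibre at p has the generic rank as its dimension.
open Module in
lemma finrank_fiber_of_isDedekindDomain_localization (p : Ideal A) [p.IsPrime]
    [IsDedekindDomain (Localization.AtPrime p)] :
    finrank p.ResidueField (p.Fiber B) = finrank A B := by
  let Ap := Localization.AtPrime p
  let Bp := LocalizedModule p.primeCompl B
  have hle : p.primeCompl ≤ nonZeroDivisors A := p.primeCompl_le_nonZeroDivisors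
  have : IsTorsionFree Ap Bp := inferInstance
  have : Module.Flat Ap Bp := inferInstance
  have : Module.Finite Ap Bp := Module.Finite.of_isLocalizedModule p.primeCompl
    (LocalizedModule.mkLinearMap p.primeCompl B)
  have : Module.Free Ap Bp := free_of_flat_of_isLocalRing
  have e : p.ResidueField ⊗[Ap] (Ap ⊗[A] B) ≃ₗ[p.ResidueField] p.Fiber B :=
    TensorProduct.AlgebraTensorModule.cancelBaseChange _ _ _ _ _
  rw [← e.finrank_eq,
    ← ((LocalizedModule.equivTensorProduct p.primeCompl B).baseChange Ap p.ResidueField _ _).finrank_eq,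
    Module.finrank_baseChange]
  exact (LocalizedModule.isBaseChange p.primeCompl B).finrank_eq

variable [Group G] [Finite G] [MulSemiringAction G B] [SMulCommClass G A B]
  [Algebra.IsInvariant A B G]

/-- The dimension of the fibre is the sum of e · f over the primes above p; they form one G-orbit,
so all terms are equal. -/
lemma ncard_primesOver_mul_ramificationIdx_mul_inertiaDeg (hG : Module.finrank A B = Nat.card G)
    (p : Ideal A) [p.IsPrime] [IsDedekindDomain (Localization.AtPrime p)]
    (Q : Ideal B) [Q.IsPrime] [Q.LiesOver p] :
    (p.primesOver B).ncard * (Q.ramificationIdx A * Q.inertiaDeg A) = Nat.card G := by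
  have : Fintype (p.primesOver B) := (Algebra.QuasiFinite.finite_primesOver p).fintype
  rw [← hG, ← finrank_fiber_of_isDedekindDomain_localization p,
    ← Ideal.sum_ramification_inertia_eq_finrank_fiber, ← smul_eq_mul,
    ← Set.fintypeCard_eq_ncard, ← Finset.card_univ, ← Finset.sum_const]
  refine Finset.sum_congr rfl fun P _ ↦ ?_
  obtain ⟨g, hg⟩ : P.1 ∈ MulAction.orbit G Q :=
    (Algebra.IsInvariant.orbit_eq_primesOver A B G p Q).symm ▸ P.2
  rw [← hg, Ideal.ramificationIdx_smul, Ideal.inertiaDeg_smul]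

end FundamentalIdentity

/-! ### Ramification index and inertia degree are unchanged by localization. -/

section Localization

variable {A B R S : Type*} [CommRing A] [CommRing B] [CommRing R] [CommRing S] [Algebra A B]
  [Algebra A R] [Algebra B S] [Algebra R S] [Algebra A S] [IsScalarTower A B S]
  [IsScalarTower A R S] [IsLocalRing R] [IsLocalRing S]
  (p : Ideal A) [p.IsPrime] (Q : Ideal B) [Q.IsPrime] [Q.LiesOver p]
  [IsLocalization.AtPrime R p] [IsLocalization.AtPrime S Q]

open IsLocalRing

include p Q

lemma liesOver_maximalIdeal_of_localization : (maximalIdeal S).LiesOver (maximalIdeal R) := by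
  have h₁ : (maximalIdeal S).LiesOver Q := IsLocalization.AtPrime.liesOver_maximalIdeal S Q _
  have h₂ : (maximalIdeal S).LiesOver p := .trans _ Q p
  constructor
  rw [← IsLocalization.AtPrime.map_eq_maximalIdeal p R, h₂.over]
  have := IsLocalization.map_under p.primeCompl R ((maximalIdeal S).under R)
  rw [← this, Ideal.under_under]

lemma ramificationIdx_maximalIdeal_of_localization :
    (maximalIdeal S).ramificationIdx R = Q.ramificationIdx A := by
  have h₁ : (maximalIdeal S).LiesOver Q := IsLocalization.AtPrime.liesOver_maximalIdeal S Q _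
  have h₂ : (maximalIdeal S).LiesOver p := .trans _ Q p
  have h₃ : (maximalIdeal S).LiesOver (maximalIdeal R) :=
    liesOver_maximalIdeal_of_localization p Q
  have : Module.Flat B S := IsLocalization.flat S Q.primeCompl
  let T := Localization.AtPrime (maximalIdeal S)
  -- Q generates the maximal ideal of S, so the quotient whose length defines the index is a field.
  have h₄ : (maximalIdeal S).ramificationIdx B = 1 := by
    rw [Ideal.ramificationIdx_eq Q (maximalIdeal S), IsScalarTower.algebraMap_eq B S T,
      ← Ideal.map_map, IsLocalization.AtPrime.map_eq_maximalIdeal Q S,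
      Localization.AtPrime.map_eq_maximalIdeal]
    have : Module.length T (T ⧸ maximalIdeal T) = 1 := by
      rw [Module.length_eq_one_iff, isSimpleModule_iff_isCoatom, ← Ideal.isMaximal_def]
      exact maximalIdeal.isMaximal T
    simp [T, this]
  rw [Ideal.ramificationIdx_eq (maximalIdeal R) (maximalIdeal S),
    ← IsLocalization.AtPrime.map_eq_maximalIdeal p R, Ideal.map_map,
    ← IsScalarTower.algebraMap_eq A R, ← Ideal.ramificationIdx_eq p (maximalIdeal S),
    Ideal.ramificationIdx_tower Q (maximalIdeal S), h₄, mul_one]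

-- Every element of the residue field is a fraction b / s with b, s from B, hence a multiple of 1
-- over the residue field of Q.
omit p in
omit [Algebra A B] [Algebra R S] [Algebra A S] [IsScalarTower A B S] [IsScalarTower A R S]
  [IsLocalRing R] [Algebra A R] in
lemma inertiaDeg_maximalIdeal_eq_one : (maximalIdeal S).inertiaDeg B = 1 := by
  have h₁ : (maximalIdeal S).LiesOver Q := IsLocalization.AtPrime.liesOver_maximalIdeal S Q _
  let := Localization.AtPrime.algebraOfLiesOver Q (maximalIdeal S)
  rw [Ideal.inertiaDeg_eq Q (maximalIdeal S)]
  refine finrank_eq_one (1 : (maximalIdeal S).ResidueField) one_ne_zero fun w ↦ ?_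
  obtain ⟨x, rfl⟩ := Ideal.algebraMap_residueField_surjective (maximalIdeal S) w
  obtain ⟨b, s, rfl⟩ := IsLocalization.exists_mk'_eq Q.primeCompl x
  refine ⟨algebraMap B Q.ResidueField b / algebraMap B Q.ResidueField s, ?_⟩
  have hs : algebraMap B (maximalIdeal S).ResidueField s ≠ 0 := by
    rw [IsScalarTower.algebraMap_apply B S]
    exact ((IsLocalization.map_units S s).map _).ne_zero
  rw [Algebra.smul_def, mul_one, map_div₀, ← IsScalarTower.algebraMap_apply B Q.ResidueField,
    ← IsScalarTower.algebraMap_apply B Q.ResidueField, div_eq_iff hs,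
    IsScalarTower.algebraMap_apply B S (maximalIdeal S).ResidueField b,
    IsScalarTower.algebraMap_apply B S (maximalIdeal S).ResidueField s, ← map_mul,
    IsLocalization.mk'_spec]

/-- The degree from A to S is computed through B and through R; each localization contributes a
factor 1. -/
lemma inertiaDeg_maximalIdeal_of_localization :
    (maximalIdeal S).inertiaDeg R = Q.inertiaDeg A := by
  have h₁ : (maximalIdeal S).LiesOver Q := IsLocalization.AtPrime.liesOver_maximalIdeal S Q _
  have h₂ : (maximalIdeal S).LiesOver p := .trans _ Q p
  have h₃ : (maximalIdeal S).LiesOver (maximalIdeal R) :=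
    liesOver_maximalIdeal_of_localization p Q
  have h₄ := Ideal.inertiaDeg_tower (R := A) Q (maximalIdeal S)
  have h₅ := Ideal.inertiaDeg_tower (R := A) (maximalIdeal R) (maximalIdeal S)
  rw [inertiaDeg_maximalIdeal_eq_one Q, mul_one] at h₄
  rw [inertiaDeg_maximalIdeal_eq_one (S := R) p, one_mul] at h₅
  rw [← h₅, h₄]

end Localization

/-! ### Group actions on rings of sections. -/

section SectionsAlgebra

variable {X Y : Scheme.{u}} (f : X ⟶ Y) (U : Y.Opens)

/-- The algebra structure of the sections over a preimage. -/
@[reducible] noncomputable def preimageAlgebra : Algebra Γ(Y, U) Γ(X, f ⁻¹ᵁ U) :=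
  (f.app U).hom.toAlgebra

end SectionsAlgebra

namespace SchemeAction

variable {G : Type v} [Group G] {X Y S : Scheme.{u}} (a : SchemeAction G X) {f : X ⟶ S}
  (ha : a.IsOver f) (U : S.Opens)

include ha in
lemma preimage_le_preimage_hom (g : G) : f ⁻¹ᵁ U ≤ a.hom g ⁻¹ᵁ f ⁻¹ᵁ U := by
  rw [← Scheme.Hom.comp_preimage, ha g]

lemma appLE_congr_hom {φ ψ : X ⟶ Y} (h : φ = ψ) {V : X.Opens} {W : Y.Opens} (e : V ≤ φ ⁻¹ᵁ W) :
    φ.appLE W V e = ψ.appLE W V (h ▸ e) := by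
  subst h; rfl

/-- The action of `G` on the sections over `f ⁻¹ᵁ U` induced by an action over `f`: the element `g`
acts as the pullback along `g⁻¹`. -/
@[reducible] noncomputable def sectionsAction : MulSemiringAction G Γ(X, f ⁻¹ᵁ U) where
  -- Pullback is contravariant, so the inverse is what makes this a left action.
  smul g s := (a.hom g⁻¹).appLE (f ⁻¹ᵁ U) (f ⁻¹ᵁ U) (a.preimage_le_preimage_hom ha U _) s
  one_smul s := by
    change (a.hom 1⁻¹).appLE (f ⁻¹ᵁ U) (f ⁻¹ᵁ U) _ s = s
    rw [appLE_congr_hom ((congr_arg a.hom inv_one).trans a.hom_one)]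
    exact congr($((Category.id_comp _).trans (X.presheaf.map_id _)) s)
  mul_smul g h s := by
    change (a.hom (g * h)⁻¹).appLE (f ⁻¹ᵁ U) (f ⁻¹ᵁ U) _ s =
      (a.hom g⁻¹).appLE (f ⁻¹ᵁ U) (f ⁻¹ᵁ U) _ ((a.hom h⁻¹).appLE (f ⁻¹ᵁ U) (f ⁻¹ᵁ U) _ s)
    rw [appLE_congr_hom ((congr_arg a.hom (mul_inv_rev g h)).trans (a.hom_mul _ _)),
      ← CommRingCat.comp_apply, Scheme.Hom.appLE_comp_appLE]
  smul_zero _ := map_zero _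
  smul_add _ := map_add _
  smul_one _ := map_one _
  smul_mul _ := map_mul _

lemma sectionsAction_smul_def (g : G) (s : Γ(X, f ⁻¹ᵁ U)) :
    letI := a.sectionsAction ha U
    g • s = (a.hom g⁻¹).appLE (f ⁻¹ᵁ U) (f ⁻¹ᵁ U) (a.preimage_le_preimage_hom ha U _) s := rfl

lemma sectionsAction_smulCommClass :
    letI := a.sectionsAction ha U
    letI := preimageAlgebra f U
    SMulCommClass G Γ(S, U) Γ(X, f ⁻¹ᵁ U) := by
  let := a.sectionsAction ha U
  let := preimageAlgebra f U
  refine ⟨fun g r s ↦ ?_⟩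
  rw [Algebra.smul_def, Algebra.smul_def, smul_mul']
  congr 1
  change ((a.hom g⁻¹).appLE (f ⁻¹ᵁ U) (f ⁻¹ᵁ U) _) (f.app U r) = f.app U r
  rw [← CommRingCat.comp_apply, Scheme.Hom.app_eq_appLE, Scheme.Hom.appLE_comp_appLE,
    appLE_congr_hom (ha g⁻¹)]

/-- The pullback of sections along an equivariant morphism is equivariant. -/
lemma smul_appLE {b : SchemeAction G Y} {h : Y ⟶ S} (hb : b.IsOver h) {φ : X ⟶ Y}
    (hφ : a.Equivariant b φ) {V : S.Opens} (e : f ⁻¹ᵁ V ≤ φ ⁻¹ᵁ h ⁻¹ᵁ U) (g : G)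
    (s : Γ(Y, h ⁻¹ᵁ U)) :
    letI := a.sectionsAction ha V
    letI := b.sectionsAction hb U
    φ.appLE (h ⁻¹ᵁ U) (f ⁻¹ᵁ V) e (g • s) = g • φ.appLE (h ⁻¹ᵁ U) (f ⁻¹ᵁ V) e s := by
  change φ.appLE (h ⁻¹ᵁ U) (f ⁻¹ᵁ V) e ((b.hom g⁻¹).appLE (h ⁻¹ᵁ U) (h ⁻¹ᵁ U) _ s) =
    (a.hom g⁻¹).appLE (f ⁻¹ᵁ V) (f ⁻¹ᵁ V) _ (φ.appLE (h ⁻¹ᵁ U) (f ⁻¹ᵁ V) e s)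
  rw [← CommRingCat.comp_apply, ← CommRingCat.comp_apply, Scheme.Hom.appLE_comp_appLE,
    Scheme.Hom.appLE_comp_appLE, appLE_congr_hom (hφ g⁻¹)]

/-- The action on points and the action on primes of the ring of sections agree. -/
lemma primeIdealOf_hom (hU : IsAffineOpen (f ⁻¹ᵁ U)) (g : G) (x : X) (hx : x ∈ f ⁻¹ᵁ U) :
    letI := a.sectionsAction ha U
    (hU.primeIdealOf ⟨a.hom g x, a.preimage_le_preimage_hom ha U g hx⟩).asIdeal =
      g • (hU.primeIdealOf ⟨x, hx⟩).asIdeal := by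
  let := a.sectionsAction ha U
  rw [← IsAffineOpen.comap_primeIdealOf_appLE (f := a.hom g) _ hU _ hU
    (a.preimage_le_preimage_hom ha U g) hx]
  ext s
  rw [Ideal.mem_pointwise_smul_iff_inv_smul_mem, sectionsAction_smul_def,
    appLE_congr_hom (congr_arg a.hom (inv_inv g))]
  exact Iff.rfl

end SchemeAction

/-! ### From the geometric torsor condition to bijectivity of `torsorMap`. -/

section Gluing

/-- Sections on a disjoint union of open subschemes are families of sections. -/
lemma existsUnique_section_of_disjoint {ι : Type*} {X : Scheme.{u}} {Y : ι → Scheme.{u}}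
    (j : ∀ i, Y i ⟶ X) [∀ i, IsOpenImmersion (j i)]
    (hj : Pairwise fun i i' ↦ Disjoint (j i).opensRange (j i').opensRange)
    (hX : ∀ x : X, ∃ i, x ∈ (j i).opensRange) (W : X.Opens) {V : ∀ i, (Y i).Opens}
    (hV : ∀ i, V i = j i ⁻¹ᵁ W) (s : ∀ i, Γ(Y i, V i)) :
    ∃! t : Γ(X, W), ∀ i, (j i).appLE W (V i) (hV i).le t = s i := by
  obtain rfl : V = fun i ↦ j i ⁻¹ᵁ W := funext hV
  have hle (i) : j i ''ᵁ j i ⁻¹ᵁ W ≤ W := by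
    rintro _ ⟨y, hy, rfl⟩
    exact hy
  have hcov : W ≤ ⨆ i, j i ''ᵁ j i ⁻¹ᵁ W := by
    intro x hx
    obtain ⟨i, y, rfl⟩ := hX x
    exact TopologicalSpace.Opens.mem_iSup.mpr ⟨i, y, hx, rfl⟩
  have key (t : Γ(X, W)) (i) : (j i).appLE W (j i ⁻¹ᵁ W) (hV i).le t = s i ↔
      X.presheaf.map (homOfLE (hle i)).op t = ((j i).appIso (j i ⁻¹ᵁ W)).inv (s i) := by
    have h := congr($((j i).appLE_appIso_inv (hV i).le) t)
    rw [CommRingCat.comp_apply] at h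
    rw [← h]
    exact ((ConcreteCategory.bijective_of_isIso ((j i).appIso (j i ⁻¹ᵁ W)).inv).1.eq_iff).symm
  simp_rw [key]
  refine X.sheaf.existsUnique_gluing' (fun i ↦ j i ''ᵁ j i ⁻¹ᵁ W) W (fun i ↦ homOfLE (hle i))
    hcov (fun i ↦ ((j i).appIso (j i ⁻¹ᵁ W)).inv (s i)) ?_
  intro i i'
  by_cases h : i = i'
  · subst h
    rfl
  -- Compatibility on distinct pieces is automatic: the overlap is empty and its ring of sections is
  -- zero.
  · have : (j i ''ᵁ j i ⁻¹ᵁ W) ⊓ (j i' ''ᵁ j i' ⁻¹ᵁ W) = ⊥ := by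
      rw [← disjoint_iff]
      exact (hj h).mono ((j i).image_le_opensRange _) ((j i').image_le_opensRange _)
    have hsub : Subsingleton Γ(X, (j i ''ᵁ j i ⁻¹ᵁ W) ⊓ (j i' ''ᵁ j i' ⁻¹ᵁ W)) := by
      rw [this]
      infer_instance
    exact hsub.elim _ _

end Gluing

section Torsor

lemma exists_tensorProduct_ringEquiv_of_isPushout {R S S' : Type u} [CommRing R] [CommRing S]
    [CommRing S'] [Algebra R S] [Algebra R S'] {T : CommRingCat.{u}} {l : .of S ⟶ T}
    {r : .of S' ⟶ T}
    (h : IsPushout (CommRingCat.ofHom (algebraMap R S)) (CommRingCat.ofHom (algebraMap R S')) l r) :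
    ∃ e : (S ⊗[R] S') ≃+* T, ∀ x y, e (x ⊗ₜ y) = l x * r y := by
  have H := CommRingCat.isPushout_tensorProduct R S S'
  let e := H.isoIsPushout _ _ h
  refine ⟨e.commRingCatIsoToRingEquiv, fun x y ↦ ?_⟩
  have h₁ : e.hom (x ⊗ₜ[R] (1 : S')) = l x := congr($(H.inl_isoIsPushout_hom _ _ h) x)
  have h₂ : e.hom ((1 : S) ⊗ₜ[R] y) = r y := congr($(H.inr_isoIsPushout_hom _ _ h) y)
  rw [← h₁, ← h₂, ← map_mul, Algebra.TensorProduct.tmul_mul_tmul, mul_one, one_mul]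
  rfl

variable {X Y : Scheme.{u}} {π : Y ⟶ X} {G : Type v} [Group G] [Finite G] {ρ : SchemeAction G Y}

lemma IsGaloisCovering.isPullback (h : IsGaloisCovering π ρ) :
    IsPullback (Sigma.desc fun _ : G ↦ 𝟙 Y) (Sigma.desc ρ.hom) π π := by
  have := h.torsor
  refine .of_iso_pullback ⟨?_⟩ (asIso (Sigma.desc (fun g : G ↦
    (pullback.lift (𝟙 Y) (ρ.hom g) ((Category.id_comp _).trans (h.isOver g).symm) :
      Y ⟶ pullback π π)))) ?_ ?_
  · refine Sigma.hom_ext _ _ fun g ↦ ?_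
    simpa using (h.isOver g).symm
  · refine Sigma.hom_ext _ _ fun g ↦ ?_
    simpa using pullback.lift_fst _ _ _
  · refine Sigma.hom_ext _ _ fun g ↦ ?_
    simpa using pullback.lift_snd _ _ _

/-- Lets the torsor square over X be read over `Xbar`, through the open immersion. -/
lemma _root_.CategoryTheory.IsPullback.comp_mono {C : Type*} [Category* C] {P X Y Z W : C}
    {f : P ⟶ X} {g : P ⟶ Y} {h : X ⟶ Z} {k : Y ⟶ Z} (H : IsPullback f g h k) (m : Z ⟶ W) [Mono m] :
    IsPullback f g (h ≫ m) (k ≫ m) :=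
  ⟨⟨by rw [← Category.assoc, H.w, Category.assoc]⟩,
    ⟨PullbackCone.IsLimit.mk _
      (fun s ↦ H.lift s.fst s.snd ((cancel_mono m).mp (by simpa using s.condition)))
      (fun s ↦ H.lift_fst _ _ _) (fun s ↦ H.lift_snd _ _ _)
      fun s l h₁ h₂ ↦ H.hom_ext (by simp [h₁]) (by simp [h₂])⟩⟩

/-- Over an affine open the pullback square becomes a pushout of rings, so S ⊗ S is the ring of
sections on a disjoint union of copies of Y indexed by G, that is, a product over G. -/
lemma torsorMap_bijective_of_isPullback {Z : Scheme.{u}} {f : Y ⟶ Z}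
    (H : IsPullback (Sigma.desc fun _ : G ↦ 𝟙 Y) (Sigma.desc ρ.hom) f f) (hρ : ρ.IsOver f)
    (D : Z.Opens) (hD : IsAffineOpen D) (hD' : IsAffineOpen (f ⁻¹ᵁ D)) :
    letI := ρ.sectionsAction hρ D
    letI := preimageAlgebra f D
    haveI := ρ.sectionsAction_smulCommClass hρ D
    Function.Bijective (torsorMap Γ(Z, D) Γ(Y, f ⁻¹ᵁ D) G) := by
  let := ρ.sectionsAction hρ D
  let alg := preimageAlgebra f D
  have := ρ.sectionsAction_smulCommClass hρ D
  let p₁ : (∐ fun _ : G ↦ Y) ⟶ Y := Sigma.desc fun _ : G ↦ 𝟙 Y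
  let p₂ : (∐ fun _ : G ↦ Y) ⟶ Y := Sigma.desc ρ.hom
  let W := p₁ ⁻¹ᵁ f ⁻¹ᵁ D ⊓ p₂ ⁻¹ᵁ f ⁻¹ᵁ D
  have hpush := (isIso_pushoutSection_iff H (le_refl (f ⁻¹ᵁ D)) le_rfl (UY := W) rfl).mp
    (isIso_pushoutSection_of_isAffineOpen H _ _ _ hD hD' hD')
  rw [← Scheme.Hom.app_eq_appLE] at hpush
  obtain ⟨e, he⟩ := exists_tensorProduct_ringEquiv_of_isPushout (R := Γ(Z, D))
    (S := Γ(Y, f ⁻¹ᵁ D)) (S' := Γ(Y, f ⁻¹ᵁ D)) hpush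
  have hW (g : G) : f ⁻¹ᵁ D = Sigma.ι (fun _ : G ↦ Y) g ⁻¹ᵁ W := by
    change _ = Sigma.ι (fun _ : G ↦ Y) g ⁻¹ᵁ p₁ ⁻¹ᵁ f ⁻¹ᵁ D ⊓
      Sigma.ι (fun _ : G ↦ Y) g ⁻¹ᵁ p₂ ⁻¹ᵁ f ⁻¹ᵁ D
    rw [← Scheme.Hom.comp_preimage, ← Scheme.Hom.comp_preimage, ← Scheme.Hom.comp_preimage,
      ← Scheme.Hom.comp_preimage, Category.assoc, Category.assoc, Sigma.ι_desc_assoc,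
      Sigma.ι_desc_assoc, hρ g, Category.id_comp, inf_idem]
  have hglue := existsUnique_section_of_disjoint.{u} (fun g : G ↦ Sigma.ι (fun _ : G ↦ Y) g)
    (fun g g' hg ↦ disjoint_opensRange_sigmaι.{u} _ g g' hg)
    (fun x ↦ (sigmaOpenCover.{u} fun _ : G ↦ Y).exists_eq x) W hW
  -- The index is inverted because g acts on sections by pullback along g⁻¹.
  let Φ (t : Γ(∐ fun _ : G ↦ Y, W)) (g : G) : Γ(Y, f ⁻¹ᵁ D) :=
    (Sigma.ι (fun _ : G ↦ Y) g⁻¹).appLE W (f ⁻¹ᵁ D) (hW g⁻¹).le t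
  have hΦ : Function.Bijective Φ := by
    rw [Function.bijective_iff_existsUnique]
    intro s
    obtain ⟨t, ht, ht'⟩ := hglue fun g ↦ s g⁻¹
    refine ⟨t, funext fun g ↦ ?_, fun t' h' ↦ ht' t' fun g ↦ ?_⟩
    · exact (ht g⁻¹).trans (congr_arg s (inv_inv g))
    · rw [← h']
      change _ = (Sigma.ι (fun _ : G ↦ Y) g⁻¹⁻¹).appLE W (f ⁻¹ᵁ D) _ t'
      rw [SchemeAction.appLE_congr_hom (congr_arg (Sigma.ι fun _ : G ↦ Y) (inv_inv g))]
  have hcomp : (torsorMap Γ(Z, D) Γ(Y, f ⁻¹ᵁ D) G : _ → _) = Φ ∘ e := by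
    funext z
    induction z with
    | zero =>
      funext g
      simp [Φ]
    | add z w hz hw =>
      rw [map_add, hz, hw]
      funext g
      simp [Φ]
    | tmul x y =>
      funext g
      rw [torsorMap_tmul]
      change _ = (Sigma.ι (fun _ : G ↦ Y) g⁻¹).appLE W (f ⁻¹ᵁ D) (hW g⁻¹).le (e (x ⊗ₜ y))
      rw [he, map_mul, ← CommRingCat.comp_apply, ← CommRingCat.comp_apply,
        Scheme.Hom.appLE_comp_appLE, Scheme.Hom.appLE_comp_appLE,
        SchemeAction.sectionsAction_smul_def,
        SchemeAction.appLE_congr_hom (Sigma.ι_desc _ _),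
        SchemeAction.appLE_congr_hom (Sigma.ι_desc _ _)]
      congr 1
      exact congr($(((Category.id_comp _).trans (Y.presheaf.map_id _)).symm) x)
  rw [hcomp]
  exact hΦ.comp e.bijective

end Torsor

/-! ### Assembling the descent statement. -/

section Descent

/-- Flatness over a domain makes R → S injective, and an injective integral extension is surjective
on spectra. -/
lemma faithfullyFlat_of_isDomain {R S : Type*} [CommRing R] [CommRing S] [Algebra R S] [IsDomain R]
    [Nontrivial S] [Module.Flat R S] [Algebra.IsIntegral R S] : Module.FaithfullyFlat R S := by
  have : Module.IsTorsionFree R S := inferInstance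
  have : FaithfulSMul R S := inferInstance
  exact .of_comap_surjective (Algebra.IsIntegral.comap_surjective R S)

variable {A A' B B' G : Type*} [CommRing A] [CommRing A'] [CommRing B] [CommRing B']
  [Algebra A A'] [Algebra A B] [Algebra A B'] [Algebra A' B'] [Algebra B B']
  [IsScalarTower A A' B'] [IsScalarTower A B B']
  [Group G] [Finite G] [MulSemiringAction G B'] [SMulCommClass G A' B']
  [IsDomain A] [IsIntegrallyClosed A]

/-- Descent of a torsor over a localization `A'` of the normal noetherian domain `A` to an integral
extension of `A`. -/
lemma isInvariant_and_finite_of_away {a : A} (ha : a ≠ 0) [IsNoetherianRing A]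
    [IsLocalization.Away a A'] [IsLocalization.Away (algebraMap A B a) B']
    [MulSemiringAction G B] [SMulDistribClass G B B']
    [Module.Finite A' B'] [Module.Flat A' B'] [Nontrivial B'] [Algebra.IsIntegral A B]
    (hB : Function.Injective (algebraMap B B')) (h : Function.Bijective (torsorMap A' B' G)) :
    Algebra.IsInvariant A B G ∧ Module.Finite A B ∧ Module.IsTorsionFree A B ∧
      Module.finrank A B = Nat.card G := by
  have hle : Submonoid.powers a ≤ nonZeroDivisors A := powers_le_nonZeroDivisors_of_noZeroDivisors ha
  have : IsDomain A' := IsLocalization.isDomain_of_le_nonZeroDivisors A' hle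
  have := faithfullyFlat_of_isDomain (R := A') (S := B')
  have hinv := isInvariant_of_torsorMap_injective h.1
  have hfin : Module.Finite A B := finite_of_away (A' := A') ha hB
    (fun g b ↦ ⟨g • b, algebraMap.coe_smul' ..⟩) hinv h.2
  have : Module.Flat A A' := IsLocalization.flat (R := A) A' (Submonoid.powers a)
  have : Module.Flat A B' := .trans A A' B'
  have : Module.IsTorsionFree A B' := inferInstance
  refine ⟨isInvariant_of_away ha hB hinv, hfin, ?_, ?_⟩
  · exact Function.Injective.moduleIsTorsionFree (algebraMap B B') hB fun r b ↦ by
      rw [Algebra.smul_def, map_mul, ← IsScalarTower.algebraMap_apply, Algebra.smul_def]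
  · have : IsLocalizedModule (Submonoid.powers a) (IsScalarTower.toAlgHom A B B').toLinearMap := by
      rw [isLocalizedModule_iff_isLocalization]
      simpa [Algebra.algebraMapSubmonoid, Submonoid.map_powers]
    rw [← finrank_eq_card_of_torsorMap_bijective h]
    exact ((IsLocalization.finrank_eq A' (Submonoid.powers a) hle).trans
      (IsLocalizedModule.finrank_eq (Submonoid.powers a)
        (IsScalarTower.toAlgHom A B B').toLinearMap hle)).symm

end Descent

/-! ### Sections of relative normalizations, flat restriction and normality. -/

section Normalization

variable {Y Z : Scheme.{u}} (f : Y ⟶ Z) [QuasiCompact f] [QuasiSeparated f]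

lemma preimage_eq_toNormalization_preimage (U : Z.Opens) :
    f ⁻¹ᵁ U = f.toNormalization ⁻¹ᵁ f.fromNormalization ⁻¹ᵁ U := by
  rw [← Scheme.Hom.comp_preimage, f.toNormalization_fromNormalization]

/-- Over an affine U the sections of the normalization are the integral closure inside the sections
of Y. -/
lemma toNormalization_appLE_injective {U : Z.Opens} (hU : IsAffineOpen U) :
    Function.Injective (f.toNormalization.appLE (f.fromNormalization ⁻¹ᵁ U) (f ⁻¹ᵁ U)
      (preimage_eq_toNormalization_preimage f U).le) := by
  let := (f.app U).hom.toAlgebra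
  intro x y h
  rw [← f.normalizationObjIso_hom_val hU] at h
  exact (ConcreteCategory.bijective_of_isIso (f.normalizationObjIso hU).hom).1
    (Subtype.val_injective h)

lemma toNormalization_appLE_bijective {U : Z.Opens} (hU : IsAffineOpen U)
    (hf : (f.app U).hom.IsIntegral) :
    Function.Bijective (f.toNormalization.appLE (f.fromNormalization ⁻¹ᵁ U) (f ⁻¹ᵁ U)
      (preimage_eq_toNormalization_preimage f U).le) := by
  refine ⟨toNormalization_appLE_injective f hU, fun y ↦ ?_⟩
  let := (f.app U).hom.toAlgebra
  refine ⟨(f.normalizationObjIso hU).inv ⟨y, hf y⟩, ?_⟩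
  rw [← f.normalizationObjIso_hom_val hU, ← CommRingCat.comp_apply, Iso.inv_hom_id_assoc]
  rfl

end Normalization

section Flat

/-- On a flat scheme over an integral scheme, restriction to the locus where a nonzero function of
the base does not vanish is injective. -/
lemma map_injective_of_flat {Y Z : Scheme.{u}} (f : Y ⟶ Z) [Flat f] [IsIntegral Z] {U : Z.Opens}
    (hU : IsAffineOpen U) [Nonempty U] {a : Γ(Z, U)} (ha : a ≠ 0) :
    Function.Injective (Y.presheaf.map
      (homOfLE (f.preimage_mono (Z.basicOpen_le a)) : f ⁻¹ᵁ Z.basicOpen a ⟶ f ⁻¹ᵁ U).op) := by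
  rw [injective_iff_map_eq_zero]
  intro s hs
  -- The preimage of U need not be affine, so vanishing is checked on affine opens V inside it.
  refine Y.sheaf.eq_of_locally_eq' (fun V : {V : Y.affineOpens // V.1 ≤ f ⁻¹ᵁ U} ↦ V.1.1) (f ⁻¹ᵁ U)
    (fun V ↦ homOfLE V.2) ?_ s 0 fun V ↦ ?_
  · intro y hy
    obtain ⟨_, ⟨V, hV, rfl⟩, hyV, hVU⟩ :=
      Y.isBasis_affineOpens.exists_subset_of_mem_open hy (f ⁻¹ᵁ U).isOpen
    exact TopologicalSpace.Opens.mem_iSup.mpr ⟨⟨⟨V, hV⟩, hVU⟩, hyV⟩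
  · rw [map_zero]
    change Y.presheaf.map (homOfLE V.2).op s = 0
    let := (f.appLE U V.1.1 V.2).hom.toAlgebra
    have : Module.Flat Γ(Z, U) Γ(Y, V.1.1) := f.flat_appLE hU V.1.2 V.2
    -- On V, a section vanishing where a is invertible is killed by a power of a, which is regular
    -- by flatness.
    obtain ⟨n, hn⟩ := exists_pow_mul_eq_zero_of_res_basicOpen_eq_zero_of_isAffineOpen Y V.1.2
      (Y.presheaf.map (homOfLE V.2).op s) (f.appLE U V.1.1 V.2 a) (by
        have hle : Y.basicOpen (f.appLE U V.1.1 V.2 a) ≤ f ⁻¹ᵁ Z.basicOpen a := by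
          rw [Scheme.Hom.appLE, CommRingCat.comp_apply, Scheme.basicOpen_res,
            ← Scheme.preimage_basicOpen]
          exact inf_le_right
        have h := congr_arg (Y.presheaf.map (homOfLE hle).op) hs
        rw [map_zero, ← CommRingCat.comp_apply, ← Functor.map_comp] at h
        change Y.presheaf.map (homOfLE (Y.basicOpen_le _)).op _ = 0
        rw [← CommRingCat.comp_apply, ← Functor.map_comp]
        exact h)
    refine Module.Flat.isSMulRegular_of_nonZeroDivisors (M := Γ(Y, V.1.1))
      (mem_nonZeroDivisors_of_ne_zero (pow_ne_zero n ha)) ?_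
    simp only [Algebra.smul_def, map_pow, mul_zero]
    exact hn

end Flat

section Normal

lemma isIntegrallyClosed_section {Z : Scheme.{u}} [IsIntegral Z]
    (hZ : ∀ z : Z, IsIntegrallyClosed (Z.presheaf.stalk z)) {U : Z.Opens} (hU : IsAffineOpen U)
    [Nonempty U] : IsIntegrallyClosed Γ(Z, U) := by
  refine .of_localization_maximal fun p _ hp ↦ ?_
  obtain ⟨x, hx⟩ : ∃ x : U, hU.primeIdealOf x = ⟨p, inferInstance⟩ :=
    hU.isoSpec.hom.homeomorph.surjective _
  have := hU.isLocalization_stalk x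
  rw [hx] at this
  have := hZ x.1
  exact .of_equiv (IsLocalization.algEquiv p.primeCompl (Z.presheaf.stalk x.1) _).toRingEquiv

end Normal

/-! ### The ring of `Ybar` over an affine open of `Xbar`. -/

namespace CoverSetup

variable {k : Type u} [Field k] {G : Type v} [Group G] [Finite G] (S : CoverSetup k G)

instance : IsIntegral S.Xbar := S.isVariety.isIntegral

instance : Etale S.π := S.isGalois.etale

instance : Surjective S.π := S.isGalois.surjective

lemma π_ι_isOver : S.ρ.IsOver (S.π ≫ S.X.ι) := fun g ↦ by
  rw [← Category.assoc, S.isGalois.isOver g]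

section AffineOpens

variable {D : S.Xbar.Opens} (hD : IsAffineOpen D) (hDX : D ≤ S.X)

include hD hDX in
lemma isAffineOpen_ι_preimage : IsAffineOpen (S.X.ι ⁻¹ᵁ D) :=
  hD.preimage_of_isOpenImmersion S.X.ι (by simpa using hDX)

include hD hDX in
lemma isAffineOpen_preimage : IsAffineOpen ((S.π ≫ S.X.ι) ⁻¹ᵁ D) :=
  (S.isAffineOpen_ι_preimage hD hDX).preimage S.π

-- Inside X the open immersion is an isomorphism on sections, so finiteness of `S.π` is all that is
-- needed.
include hD hDX in
lemma finite_app : ((S.π ≫ S.X.ι).app D).hom.Finite := by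
  have h : Function.Bijective (S.X.ι.app D) :=
    have := S.X.ι.isIso_app D (by simpa using hDX)
    ConcreteCategory.bijective_of_isIso (S.X.ι.app D)
  have h' : (S.π.app (S.X.ι ⁻¹ᵁ D)).hom.Finite :=
    S.π.finite_app _ (S.isAffineOpen_ι_preimage hD hDX)
  exact congr(RingHom.Finite (CommRingCat.Hom.hom $(Scheme.Hom.comp_app S.π S.X.ι D))).mpr
    (h'.comp (.of_surjective _ h.2))

end AffineOpens

lemma exists_basicOpen_le {U : S.Xbar.Opens} (hU : IsAffineOpen U) [hne : Nonempty U]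
    (hX : (S.X : Set S.Xbar).Nonempty) :
    ∃ a : Γ(S.Xbar, U), S.Xbar.basicOpen a ≤ S.X ∧ Nonempty (S.Xbar.basicOpen a) ∧ a ≠ 0 := by
  obtain ⟨x, hxU, hxX⟩ : ((U : Set S.Xbar) ∩ S.X).Nonempty :=
    nonempty_preirreducible_inter U.isOpen S.X.isOpen (Set.nonempty_coe_sort.mp hne) hX
  obtain ⟨a, ha, hxa⟩ := hU.exists_basicOpen_le ⟨x, hxX⟩ hxU
  refine ⟨a, ha, ⟨⟨x, hxa⟩⟩, ?_⟩
  rintro rfl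
  rw [Scheme.basicOpen_zero] at hxa
  exact hxa

lemma X_nonempty : (S.X : Set S.Xbar).Nonempty := by
  have := S.isGalois.connected
  obtain ⟨y⟩ : Nonempty S.Y := inferInstance
  exact ⟨(S.π y).1, (S.π y).2⟩

/-- Over an affine open of `Xbar`, the ring of `Ybar` is finite and torsion free of rank `|G|`, with
the ring of `Xbar` as its ring of invariants. -/
lemma isInvariant_and_finite {U : S.Xbar.Opens} (hU : IsAffineOpen U) [Nonempty U] :
    letI := S.actionYbar.sectionsAction S.actionYbar_isOver U
    letI := preimageAlgebra S.πbar U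
    Algebra.IsInvariant Γ(S.Xbar, U) Γ(S.Ybar, S.πbar ⁻¹ᵁ U) G ∧
      Module.Finite Γ(S.Xbar, U) Γ(S.Ybar, S.πbar ⁻¹ᵁ U) ∧
      Module.IsTorsionFree Γ(S.Xbar, U) Γ(S.Ybar, S.πbar ⁻¹ᵁ U) ∧
      Module.finrank Γ(S.Xbar, U) Γ(S.Ybar, S.πbar ⁻¹ᵁ U) = Nat.card G := by
  let := S.actionYbar.sectionsAction S.actionYbar_isOver U
  let := preimageAlgebra S.πbar U
  obtain ⟨a, haX, hne, ha⟩ := S.exists_basicOpen_le hU S.X_nonempty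
  let f := S.π ≫ S.X.ι
  let D := S.Xbar.basicOpen a
  have hDU : D ≤ U := S.Xbar.basicOpen_le a
  have hD : IsAffineOpen D := hU.basicOpen a
  let := S.ρ.sectionsAction S.π_ι_isOver D
  let := preimageAlgebra f D
  have := S.ρ.sectionsAction_smulCommClass S.π_ι_isOver D
  have htors := torsorMap_bijective_of_isPullback (S.isGalois.isPullback.comp_mono S.X.ι)
    S.π_ι_isOver D hD (S.isAffineOpen_preimage hD haX)
  have hle : f ⁻¹ᵁ D ≤ S.inclY ⁻¹ᵁ S.πbar ⁻¹ᵁ U :=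
    (f.preimage_mono hDU).trans (preimage_eq_toNormalization_preimage f U).le
  let : Algebra Γ(S.Ybar, S.πbar ⁻¹ᵁ U) Γ(S.Y, f ⁻¹ᵁ D) :=
    (S.inclY.appLE (S.πbar ⁻¹ᵁ U) (f ⁻¹ᵁ D) hle).hom.toAlgebra
  let : Algebra Γ(S.Xbar, U) Γ(S.Y, f ⁻¹ᵁ D) :=
    (f.appLE U (f ⁻¹ᵁ D) (f.preimage_mono hDU)).hom.toAlgebra
  have : IsScalarTower Γ(S.Xbar, U) Γ(S.Xbar, D) Γ(S.Y, f ⁻¹ᵁ D) := by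
    refine .of_algebraMap_eq' ?_
    change (f.appLE U (f ⁻¹ᵁ D) _).hom =
      (S.Xbar.presheaf.map (homOfLE hDU).op ≫ f.app D).hom
    rw [Scheme.Hom.app_eq_appLE, Scheme.Hom.map_appLE]
  have : IsScalarTower Γ(S.Xbar, U) Γ(S.Ybar, S.πbar ⁻¹ᵁ U) Γ(S.Y, f ⁻¹ᵁ D) := by
    refine .of_algebraMap_eq' ?_
    change (f.appLE U (f ⁻¹ᵁ D) _).hom =
      (S.πbar.app U ≫ S.inclY.appLE (S.πbar ⁻¹ᵁ U) (f ⁻¹ᵁ D) hle).hom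
    rw [Scheme.Hom.app_eq_appLE, Scheme.Hom.appLE_comp_appLE,
      SchemeAction.appLE_congr_hom S.inclY_πbar]
  have := isIntegrallyClosed_section S.isVariety.normal hU
  have : IsNoetherianRing Γ(S.Xbar, U) := IsLocallyNoetherian.component_noetherian ⟨U, hU⟩
  have : IsLocalization.Away a Γ(S.Xbar, D) := hU.isLocalization_basicOpen a
  -- Over D the sections of Y are already integral, so normalization adds nothing there and they are
  -- the localization of the ring of `Ybar` at a.
  have : IsLocalization.Away (algebraMap Γ(S.Xbar, U) Γ(S.Ybar, S.πbar ⁻¹ᵁ U) a)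
      Γ(S.Y, f ⁻¹ᵁ D) := by
    let : Algebra Γ(S.Ybar, S.πbar ⁻¹ᵁ U) Γ(S.Ybar, S.πbar ⁻¹ᵁ D) :=
      (S.Ybar.presheaf.map (homOfLE (S.πbar.preimage_mono hDU)).op).hom.toAlgebra
    have : IsLocalization.Away (algebraMap Γ(S.Xbar, U) Γ(S.Ybar, S.πbar ⁻¹ᵁ U) a)
        Γ(S.Ybar, S.πbar ⁻¹ᵁ D) :=
      (hU.preimage S.πbar).isLocalization_of_eq_basicOpen _ (homOfLE (S.πbar.preimage_mono hDU))
        (S.πbar.preimage_basicOpen a)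
    let φ : Γ(S.Ybar, S.πbar ⁻¹ᵁ D) →ₐ[Γ(S.Ybar, S.πbar ⁻¹ᵁ U)] Γ(S.Y, f ⁻¹ᵁ D) :=
      { (S.inclY.appLE (S.πbar ⁻¹ᵁ D) (f ⁻¹ᵁ D)
          (preimage_eq_toNormalization_preimage f D).le).hom with
        commutes' b := congr($(S.inclY.map_appLE _ (homOfLE (S.πbar.preimage_mono hDU)).op) b) }
    exact IsLocalization.isLocalization_of_algEquiv _ (AlgEquiv.ofBijective φ
      (toNormalization_appLE_bijective f hD (S.finite_app hD haX).to_isIntegral))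
  have : SMulDistribClass G Γ(S.Ybar, S.πbar ⁻¹ᵁ U) Γ(S.Y, f ⁻¹ᵁ D) := by
    refine ⟨fun g b c ↦ ?_⟩
    rw [Algebra.smul_def, Algebra.smul_def, smul_mul']
    congr 1
    exact (S.ρ.smul_appLE S.π_ι_isOver U S.actionYbar_isOver S.inclY_equivariant hle g b).symm
  have : Module.Finite Γ(S.Xbar, D) Γ(S.Y, f ⁻¹ᵁ D) := S.finite_app hD haX
  have : Module.Flat Γ(S.Xbar, D) Γ(S.Y, f ⁻¹ᵁ D) := by
    rw [← RingHom.flat_algebraMap_iff]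
    change (f.app D).hom.Flat
    rw [Scheme.Hom.app_eq_appLE]
    exact f.flat_appLE hD (S.isAffineOpen_preimage hD haX) le_rfl
  have : Nontrivial Γ(S.Y, f ⁻¹ᵁ D) := by
    obtain ⟨x, hx⟩ := hne
    obtain ⟨y, hy⟩ := S.π.surjective ⟨x, haX hx⟩
    have : Nonempty (f ⁻¹ᵁ D) := ⟨⟨y, by
      change (S.π y).1 ∈ D
      rwa [hy]⟩⟩
    infer_instance
  have : Algebra.IsIntegral Γ(S.Xbar, U) Γ(S.Ybar, S.πbar ⁻¹ᵁ U) := by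
    exact ⟨S.πbar.isIntegral_app _ hU⟩
  refine isInvariant_and_finite_of_away ha ?_ htors
  -- Restriction to D factors through the sections of Y over U: injective first as an integral
  -- closure, then by flatness.
  have h₁ := toNormalization_appLE_injective f hU
  have h₂ := map_injective_of_flat f hU ha
  change Function.Injective (S.inclY.appLE (S.πbar ⁻¹ᵁ U) (f ⁻¹ᵁ D) hle)
  have hle' : f ⁻¹ᵁ U ≤ S.inclY ⁻¹ᵁ S.πbar ⁻¹ᵁ U := (preimage_eq_toNormalization_preimage f U).le
  rw [← S.inclY.appLE_map hle' (homOfLE (f.preimage_mono hDU)).op]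
  exact h₂.comp h₁

end CoverSetup

/-! ### Points of fibres as primes, and local invariants read on those primes. -/

section Fibers

variable {X Z : Scheme.{u}} (f : X ⟶ Z) {U : Z.Opens} (hU : IsAffineOpen U)
  (hU' : IsAffineOpen (f ⁻¹ᵁ U))

lemma primeIdealOf_injective {U : Z.Opens} (hU : IsAffineOpen U) :
    Function.Injective hU.primeIdealOf :=
  hU.isoSpec.hom.homeomorph.injective

lemma primeIdealOf_surjective {U : Z.Opens} (hU : IsAffineOpen U) :
    Function.Surjective hU.primeIdealOf :=
  hU.isoSpec.hom.homeomorph.surjective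

lemma liesOver_primeIdealOf_iff {x : X} (hx : x ∈ f ⁻¹ᵁ U) {z : Z} (hz : z ∈ U) :
    letI := preimageAlgebra f U
    (hU'.primeIdealOf ⟨x, hx⟩).asIdeal.LiesOver (hU.primeIdealOf ⟨z, hz⟩).asIdeal ↔ f x = z := by
  let := preimageAlgebra f U
  have h := IsAffineOpen.comap_primeIdealOf_appLE U hU _ hU' (f := f) le_rfl hx
  rw [← Scheme.Hom.app_eq_appLE] at h
  rw [Ideal.liesOver_iff]
  change _ = ((hU'.primeIdealOf ⟨x, hx⟩).comap (f.app U).hom).asIdeal ↔ _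
  rw [h, eq_comm, ← PrimeSpectrum.ext_iff, (primeIdealOf_injective hU).eq_iff]
  exact Subtype.mk_eq_mk

include hU' in
lemma ncard_fiber_eq_ncard_primesOver {z : Z} (hz : z ∈ U) :
    letI := preimageAlgebra f U
    {x : X | f x = z}.ncard =
      ((hU.primeIdealOf ⟨z, hz⟩).asIdeal.primesOver Γ(X, f ⁻¹ᵁ U)).ncard := by
  let := preimageAlgebra f U
  have hmem {x : X} (hx : f x = z) : x ∈ f ⁻¹ᵁ U := by
    change f x ∈ U
    rwa [hx]
  refine Set.ncard_congr (fun x hx ↦ (hU'.primeIdealOf ⟨x, hmem hx⟩).asIdeal) (fun x hx ↦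
    ⟨inferInstance, (liesOver_primeIdealOf_iff f hU hU' (hmem hx) hz).mpr hx⟩) ?_ ?_
  · intro x x' hx hx' h
    exact congr_arg Subtype.val (primeIdealOf_injective hU' (PrimeSpectrum.ext h))
  · rintro P ⟨hP, hP'⟩
    obtain ⟨⟨x, hx⟩, h⟩ := primeIdealOf_surjective hU' ⟨P, hP⟩
    have h' : (hU'.primeIdealOf ⟨x, hx⟩).asIdeal = P := congr_arg PrimeSpectrum.asIdeal h
    exact ⟨x, (liesOver_primeIdealOf_iff f hU hU' hx hz).mp (h' ▸ hP'), h'⟩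

include hU hU' in
lemma ramificationIdx_stalk_and_residueDegree (x : X) (hx : f x ∈ U) :
    letI := preimageAlgebra f U
    letI := (f.stalkMap x).hom.toAlgebra
    (IsLocalRing.maximalIdeal (X.presheaf.stalk x)).ramificationIdx (Z.presheaf.stalk (f x)) =
      (hU'.primeIdealOf ⟨x, hx⟩).asIdeal.ramificationIdx Γ(Z, U) ∧
    (letI := (f.residueFieldMap x).hom.toAlgebra
     Module.finrank (Z.residueField (f x)) (X.residueField x)) =
      (hU'.primeIdealOf ⟨x, hx⟩).asIdeal.inertiaDeg Γ(Z, U) := by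
  let := preimageAlgebra f U
  let := (f.stalkMap x).hom.toAlgebra
  let p := (hU.primeIdealOf ⟨f x, hx⟩).asIdeal
  let Q := (hU'.primeIdealOf ⟨x, hx⟩).asIdeal
  have : Q.LiesOver p := (liesOver_primeIdealOf_iff f hU hU' hx hx).mpr rfl
  let : Algebra Γ(Z, U) (Z.presheaf.stalk (f x)) := (Z.presheaf.germ U (f x) hx).hom.toAlgebra
  let : Algebra Γ(X, f ⁻¹ᵁ U) (X.presheaf.stalk x) :=
    (X.presheaf.germ (f ⁻¹ᵁ U) x hx).hom.toAlgebra
  let : Algebra Γ(Z, U) (X.presheaf.stalk x) :=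
    (f.app U ≫ X.presheaf.germ (f ⁻¹ᵁ U) x hx).hom.toAlgebra
  have : IsScalarTower Γ(Z, U) Γ(X, f ⁻¹ᵁ U) (X.presheaf.stalk x) := .of_algebraMap_eq' rfl
  have : IsScalarTower Γ(Z, U) (Z.presheaf.stalk (f x)) (X.presheaf.stalk x) :=
    .of_algebraMap_eq' (congr_arg CommRingCat.Hom.hom (f.germ_stalkMap U x hx).symm)
  have : IsLocalization.AtPrime (Z.presheaf.stalk (f x)) p := hU.isLocalization_stalk ⟨f x, hx⟩
  have : IsLocalization.AtPrime (X.presheaf.stalk x) Q := hU'.isLocalization_stalk ⟨x, hx⟩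
  refine ⟨ramificationIdx_maximalIdeal_of_localization p Q, ?_⟩
  rw [← inertiaDeg_maximalIdeal_of_localization (R := Z.presheaf.stalk (f x))
    (S := X.presheaf.stalk x) p Q]
  have := liesOver_maximalIdeal_of_localization (R := Z.presheaf.stalk (f x))
    (S := X.presheaf.stalk x) p Q
  rw [Ideal.inertiaDeg_eq_of_isMaximal (IsLocalRing.maximalIdeal (Z.presheaf.stalk (f x)))]
  let := (f.residueFieldMap x).hom.toAlgebra
  refine Algebra.finrank_eq_of_equiv_equiv (RingEquiv.refl (Z.residueField (f x)))
    (RingEquiv.refl (X.residueField x)) ?_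
  ext r
  obtain ⟨r, rfl⟩ := Ideal.Quotient.mk_surjective r
  rfl

end Fibers

namespace CoverSetup

variable {k : Type u} [Field k] {G : Type v} [Group G] [Finite G] (S : CoverSetup k G)

/-- A normal noetherian local domain of dimension at most one is a field or a discrete valuation
ring. -/
lemma isPrincipalIdealRing_stalk (z : S.Xbar)
    (h : Ring.KrullDimLE 1 (S.Xbar.presheaf.stalk z)) :
    IsPrincipalIdealRing (S.Xbar.presheaf.stalk z) := by
  have := S.isVariety.normal z
  have : Ring.DimensionLEOne (S.Xbar.presheaf.stalk z) :=
    ⟨fun hp hp' ↦ hp'.isMaximal_of_ne_bot hp⟩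
  have : IsDedekindRing (S.Xbar.presheaf.stalk z) := {}
  have : IsDedekindDomain (S.Xbar.presheaf.stalk z) := {}
  exact ((tfae_of_isNoetherianRing_of_isLocalRing_of_isDomain
    (S.Xbar.presheaf.stalk z)).out 2 0).mp this

/-- The group `G` permutes the points of the fibers of `Ybar` transitively. -/
lemma exists_actionYbar_eq {η η' : S.Ybar} (h : S.πbar η = S.πbar η') :
    ∃ g : G, S.actionYbar.hom g η = η' := by
  obtain ⟨_, ⟨U, hU : IsAffineOpen U, rfl⟩, hηU, -⟩ :=
    S.Xbar.isBasis_affineOpens.exists_subset_of_mem_open (Set.mem_univ (S.πbar η)) isOpen_univ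
  have : Nonempty U := ⟨⟨_, hηU⟩⟩
  have hU' := hU.preimage S.πbar
  let := S.actionYbar.sectionsAction S.actionYbar_isOver U
  let := preimageAlgebra S.πbar U
  have := S.actionYbar.sectionsAction_smulCommClass S.actionYbar_isOver U
  obtain ⟨hinv, -⟩ := S.isInvariant_and_finite hU
  have hη' : η' ∈ S.πbar ⁻¹ᵁ U := by
    change S.πbar η' ∈ U
    rwa [← h]
  obtain ⟨g, hg⟩ := Algebra.IsInvariant.exists_smul_of_under_eq Γ(S.Xbar, U)
    Γ(S.Ybar, S.πbar ⁻¹ᵁ U) G (hU'.primeIdealOf ⟨η, hηU⟩).asIdeal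
    (hU'.primeIdealOf ⟨η', hη'⟩).asIdeal
    (by
      rw [← ((liesOver_primeIdealOf_iff S.πbar hU hU' (x := η) hηU hηU).mpr rfl).over,
        ← ((liesOver_primeIdealOf_iff S.πbar hU hU' hη' hηU).mpr h.symm).over])
  refine ⟨g, ?_⟩
  rw [← S.actionYbar.primeIdealOf_hom S.actionYbar_isOver U hU' g η hηU] at hg
  exact congr_arg Subtype.val (primeIdealOf_injective hU' (PrimeSpectrum.ext hg)).symm

/-- The fundamental identity at a point of codimension at most one. -/
lemma ncard_fiber_mul_ramificationIndex (η : S.Ybar)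
    (h : Ring.KrullDimLE 1 (S.Xbar.presheaf.stalk (S.πbar η))) :
    {η' : S.Ybar | S.πbar η' = S.πbar η}.ncard *
      (S.ramificationIndex η * (S.residueSepDegree η * S.residueInsepDegree η)) = Nat.card G := by
  obtain ⟨_, ⟨U, hU : IsAffineOpen U, rfl⟩, hηU, -⟩ :=
    S.Xbar.isBasis_affineOpens.exists_subset_of_mem_open (Set.mem_univ (S.πbar η)) isOpen_univ
  have : Nonempty U := ⟨⟨_, hηU⟩⟩
  have hU' := hU.preimage S.πbar
  let := S.actionYbar.sectionsAction S.actionYbar_isOver U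
  let := preimageAlgebra S.πbar U
  have := S.actionYbar.sectionsAction_smulCommClass S.actionYbar_isOver U
  obtain ⟨hinv, hfin, htors, hrank⟩ := S.isInvariant_and_finite hU
  obtain ⟨he, hf⟩ := ramificationIdx_stalk_and_residueDegree S.πbar hU hU' η hηU
  have hf' : S.residueSepDegree η * S.residueInsepDegree η =
      letI := (S.πbar.residueFieldMap η).hom.toAlgebra
      Module.finrank (S.Xbar.residueField (S.πbar η)) (S.Ybar.residueField η) :=
    letI := (S.πbar.residueFieldMap η).hom.toAlgebra
    Field.finSepDegree_mul_finInsepDegree _ _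
  let p := (hU.primeIdealOf ⟨S.πbar η, hηU⟩).asIdeal
  have : (hU'.primeIdealOf ⟨η, hηU⟩).asIdeal.LiesOver p :=
    (liesOver_primeIdealOf_iff S.πbar hU hU' hηU hηU).mpr rfl
  have : IsDedekindDomain (Localization.AtPrime p) := by
    have := hU.isLocalization_stalk ⟨S.πbar η, hηU⟩
    let : Algebra Γ(S.Xbar, U) (S.Xbar.presheaf.stalk (S.πbar η)) :=
      (S.Xbar.presheaf.germ U (S.πbar η) hηU).hom.toAlgebra
    have : IsLocalization.AtPrime (S.Xbar.presheaf.stalk (S.πbar η)) p :=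
      hU.isLocalization_stalk ⟨S.πbar η, hηU⟩
    have e := (IsLocalization.algEquiv p.primeCompl (S.Xbar.presheaf.stalk (S.πbar η))
      (Localization.AtPrime p)).toRingEquiv
    have := S.isPrincipalIdealRing_stalk _ h
    have : IsPrincipalIdealRing (Localization.AtPrime p) :=
      .of_surjective e.toRingHom e.surjective
    infer_instance
  rw [hf', ncard_fiber_eq_ncard_primesOver S.πbar hU hU' hηU,
    ← ncard_primesOver_mul_ramificationIdx_mul_inertiaDeg hrank p
      (hU'.primeIdealOf ⟨η, hηU⟩).asIdeal]
  exact congr_arg₂ (fun m n ↦ _ * (m * n)) he hf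

end CoverSetup

/-! ### Components, generic points and orbits. -/

section Components

variable {T : Type*} [TopologicalSpace T]

/-- Every point of a closed subset of a sober space specializes from a generic point of a
component. -/
lemma exists_isComponent_isGenericIn [QuasiSober T] {Z : Set T} (hZ : IsClosed Z) {ξ : T}
    (hξ : ξ ∈ Z) : ∃ E z, IsComponent Z E ∧ IsGenericIn E z ∧ ξ ∈ E := by
  -- Zorn's lemma applies because the union of a nonempty chain of irreducible sets is irreducible.
  obtain ⟨E, hξE, hE⟩ : ∃ E, {ξ} ⊆ E ∧ Maximal (· ∈ {E : Set T | E ⊆ Z ∧ IsIrreducible E}) E := by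
    refine zorn_subset_nonempty _ (fun c hc hchain ⟨E₀, hE₀⟩ ↦ ⟨⋃₀ c,
      ⟨Set.sUnion_subset fun E hE ↦ (hc hE).1,
        (hc hE₀).2.1.mono (Set.subset_sUnion_of_mem hE₀), ?_⟩,
      fun E hE ↦ Set.subset_sUnion_of_mem hE⟩) {ξ}
      ⟨Set.singleton_subset_iff.mpr hξ, isIrreducible_singleton⟩
    rintro U V hU hV ⟨p, ⟨E, hE, hpE⟩, hpU⟩ ⟨q, ⟨F, hF, hqF⟩, hqV⟩
    obtain h | h := hchain.total hE hF
    · obtain ⟨r, hr⟩ := (hc hF).2.2 U V hU hV ⟨p, h hpE, hpU⟩ ⟨q, hqF, hqV⟩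
      exact ⟨r, ⟨F, hF, hr.1⟩, hr.2⟩
    · obtain ⟨r, hr⟩ := (hc hE).2.2 U V hU hV ⟨p, hpE, hpU⟩ ⟨q, h hqF, hqV⟩
      exact ⟨r, ⟨E, hE, hr.1⟩, hr.2⟩
  have hcl : IsClosed E := by
    rw [← closure_eq_iff_isClosed]
    exact (hE.2 ⟨closure_minimal hE.1.1 hZ, hE.1.2.closure⟩ subset_closure).antisymm subset_closure
  obtain ⟨z, hz⟩ := QuasiSober.sober hE.1.2 hcl
  exact ⟨E, z, hE, ⟨hz.mem, hz.def.ge⟩, hξE rfl⟩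

end Components

namespace SchemeAction

variable {G : Type v} [Group G] {X : Scheme.{u}} (a : SchemeAction G X)

/-- The orbit-stabilizer theorem for the points of a scheme. -/
lemma ncard_range_mul_card_stabilizer (x : X) :
    (Set.range fun g ↦ a.hom g x).ncard * Nat.card (a.stabilizer x) = Nat.card G := by
  let : MulAction G X :=
    { smul g x := a.hom g x
      one_smul x := by
        change a.hom 1 x = x
        rw [a.hom_one]
        rfl
      mul_smul g h x := by
        change a.hom (g * h) x = a.hom g (a.hom h x)
        rw [a.hom_mul, Scheme.Hom.comp_apply] }
  rw [← Nat.card_congr (MulAction.orbitProdStabilizerEquivGroup G x), Nat.card_prod]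
  rfl

end SchemeAction

/-! ### The codimension of ξ and the orbit on the curve. -/

namespace CoverSetup

variable {k : Type u} [Field k] {G : Type v} [Group G] [Finite G] (S : CoverSetup k G)

/-- The generic point of a component of the boundary of the regular locus has codimension one. -/
lemma krullDimLE_one_of_isComponent {D₀ : Set S.Xbar}
    (hD₀ : IsComponent (regularLocus S.Xbar \ S.X) D₀) {ξ : S.Xbar} (hξ : IsGenericIn D₀ ξ) :
    Ring.KrullDimLE 1 (S.Xbar.presheaf.stalk ξ) := by
  obtain ⟨E, z, hE, hz, hξE⟩ :=
    exists_isComponent_isGenericIn S.X.isOpen.isClosed_compl (hD₀.1.1 hξ.1).2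
  have hdim : Ring.KrullDimLE 1 (S.Xbar.presheaf.stalk z) :=
    Ring.krullDimLE_iff.mpr (S.isDivisor E z hE hz).le
  have := S.isPrincipalIdealRing_stalk z hdim
  -- The divisor condition concerns components of the whole complement, whereas D₀ is one of its
  -- regular part. The generic point z of a full component through ξ is itself regular, so adjoining
  -- z to D₀ stays within the regular part; maximality of D₀ then forces z = ξ.
  have hreg : z ∈ regularLocus S.Xbar :=
    inferInstanceAs (IsRegularLocalRing (S.Xbar.presheaf.stalk z))
  have hle : D₀ ⊆ closure {z} :=
    hξ.2.trans (closure_minimal (Set.singleton_subset_iff.mpr (hz.2 hξE)) isClosed_closure)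
  have hirr : IsIrreducible (insert z D₀) := by
    rw [← isIrreducible_iff_closure]
    have : closure (insert z D₀) = closure {z} :=
      (closure_minimal (Set.insert_subset (subset_closure (Set.mem_singleton z)) hle)
        isClosed_closure).antisymm
        (closure_mono (Set.singleton_subset_iff.mpr (Set.mem_insert z D₀)))
    rw [this]
    exact isIrreducible_singleton.closure
  have hmem : z ∈ D₀ := hD₀.2
    ⟨Set.insert_subset ⟨hreg, hE.1.1 hz.1⟩ hD₀.1.1, hirr⟩ (Set.subset_insert z D₀) (Set.mem_insert _ _)
  have heq : z = ξ := (specializes_iff_mem_closure.mpr (hle hξ.1)).antisymm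
    (specializes_iff_mem_closure.mpr (hξ.2 hmem)) |>.eq
  rwa [← heq]

variable {Cbar : Scheme.{u}} (i : Cbar ⟶ S.Xbar) {D₀ : Set S.Xbar} {ξ : S.Xbar}

/-- Two points of `Dbar` over the same point of the curve lie in one fibre of `Ybar`, so some g
carries one to the other there; the closed immersion into `Ybar` is injective, so g does so in
`Dbar` too. -/
lemma range_actionDnorm [IsClosedImmersion i] (y : S.Dnorm i) :
    S.ν i '' Set.range (fun g ↦ (S.actionDnorm i).hom g y) =
      {d | S.πbarC i d = S.πbarC i (S.ν i y)} := by
  have hν (g : G) : S.ν i ((S.actionDnorm i).hom g y) = (S.actionDbar i).hom g (S.ν i y) := by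
    rw [← Scheme.Hom.comp_apply, S.ν_equivariant i g, Scheme.Hom.comp_apply]
  have hsnd (g : G) : (S.actionDbar i).hom g ≫ S.πbarC i = S.πbarC i :=
    S.actionYbar.baseChangeMap_snd S.actionYbar_isOver _ g
  have hfst (g : G) : (S.actionDbar i).hom g ≫ S.Dbarfst i = S.Dbarfst i ≫ S.actionYbar.hom g :=
    S.actionYbar.baseChangeMap_fst S.actionYbar_isOver _ g
  have hcond : S.Dbarfst i ≫ S.πbar = S.πbarC i ≫ i := pullback.condition
  have hcl : IsClosedImmersion (S.Dbarfst i) :=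
    inferInstanceAs (IsClosedImmersion (pullback.fst S.πbar i))
  ext d
  constructor
  · rintro ⟨_, ⟨g, rfl⟩, rfl⟩
    change S.πbarC i (S.ν i ((S.actionDnorm i).hom g y)) = _
    rw [hν, ← Scheme.Hom.comp_apply, hsnd]
  · intro hd
    have h : S.πbar (S.Dbarfst i (S.ν i y)) = S.πbar (S.Dbarfst i d) := by
      rw [← Scheme.Hom.comp_apply, hcond, ← Scheme.Hom.comp_apply (S.Dbarfst i), hcond,
        Scheme.Hom.comp_apply, Scheme.Hom.comp_apply]
      exact congr_arg i hd.symm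
    obtain ⟨g, hg⟩ := S.exists_actionYbar_eq h
    refine ⟨_, ⟨g, rfl⟩, (S.Dbarfst i).isClosedEmbedding.injective ?_⟩
    change S.Dbarfst i (S.ν i ((S.actionDnorm i).hom g y)) = _
    rw [hν, ← Scheme.Hom.comp_apply, hfst, Scheme.Hom.comp_apply, hg]

end CoverSetup

end FierceRamification

/-! ### Comparison of the two counts. -/

open CategoryTheory CategoryTheory.Limits AlgebraicGeometry FierceRamification in
theorem theorem3p3 {k : Type u} [Field k] [IsAlgClosed k] {G : Type v} [Group G] [Finite G]
    (S : CoverSetup k G)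
    (D₀ : Set S.Xbar) (hD₀ : IsComponent (regularLocus S.Xbar \ S.X) D₀)
    (ξ : S.Xbar) (hξ : IsGenericIn D₀ ξ)
    {Cbar : Scheme.{u}} (i : Cbar ⟶ S.Xbar) (hC : S.IsInGoodPosition i D₀ ξ)
    (x : Cbar) (hx : IsClosed {x}) (hxD₀ : i x ∈ D₀)
    (y : S.Dnorm i) (hy : IsClosed {y}) (hyx : S.πbarC i (S.ν i y) = x)
    (η : S.Ybar) (hη : S.πbar η = ξ) :
    Nat.card (S.decompositionGroup i y) = S.ramificationIndex η * S.residueInsepDegree η := by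
  have := hC.isClosedImmersion
  have hν : Function.Injective (S.ν i) :=
    (MorphismProperty.universally_le _ _ hC.unibranch : IsHomeomorph (S.ν i)).injective
  have h₁ := (S.actionDnorm i).ncard_range_mul_card_stabilizer y
  rw [← Set.ncard_image_of_injective _ hν, S.range_actionDnorm, hyx,
    hC.card_fiber x hx hxD₀ η hη] at h₁
  have hdim := S.krullDimLE_one_of_isComponent hD₀ hξ
  subst hη
  have h₂ := S.ncard_fiber_mul_ramificationIndex η hdim
  have hG : Nat.card G ≠ 0 := Nat.card_pos.ne'
  -- `ncard` and `finSepDegree` may take the junk value 0; here their product divides |G| > 0, which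
  -- justifies the cancellation.
  have h₃ : {η' : S.Ybar | S.πbar η' = S.πbar η}.ncard * S.residueSepDegree η ≠ 0 := by
    intro h
    rw [h, zero_mul] at h₁
    exact hG h₁.symm
  refine Nat.eq_of_mul_eq_mul_left (Nat.pos_of_ne_zero h₃) (h₁.trans ?_)
  rw [← h₂]
  ring
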